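/- Let $p,q\ge 0$, $n=p+q\ge 1$, $g=\mathrm{diag}(1,\dots,1,-1,\dots,-1)$ ($p$ plus signs, $q$ minus signs), and let $U\subset\mathbb R^n$ be open (the domain of an adapted coordinate system of a conformally flat manifold). Let $\mathbb K=\mathbb R$ or $\mathbb C$, let $C^\infty(U)$ be the $\mathbb K$-valued smooth functions on $U$, and let $\lambda,\mu\in\mathbb K$, $\delta=\mu-\lambda$. The conformal Lie algebra $\mathrm o(p+1,q+1)$ is spanned over $\mathbb R$ by the vector fields $$X_i=\partial_i,\quad X_{ij}=x_i\partial_j-x_j\partial_i,\quad X_0=x^i\partial_i,\quad \bar X_i=x_jx^j\partial_i-2x_ix^j\partial_j\qquad(x_i=g_{ij}x^j).$$ (Repeated indices are summed.) It acts on the space $\mathcal S^2_\delta$ of symbols $P(\xi)=P_2^{ij}\xi_i\xi_j+P_1^i\xi_i+P_0$, with $P_2^{ij}=P_2^{ji},P_1^i,P_0\in C^\infty(U)$, by $L^\delta_XP=(X^k\partial_{x^k}-\xi_j\,\partial_kX^j\,\partial_{\xi_k})P+\delta\,\mathrm{Div}(X)P$. It acts on the space $\mathcal D^2_{\lambda,\mu}$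 of differential operators $A=A_2^{ij}\partial_i\partial_j+A_1^i\partial_i+A_0$ of order at most two, with coefficients in $C^\infty(U)$ and $A_2^{ij}=A_2^{ji}$, by $L_X^{\lambda,\mu}A=L_X^\mu A-AL_X^\lambda$, where $L_X^w f=X(f)+w\,\mathrm{Div}(X)f$. A linear map $\mathcal Q:\mathcal S^2_\delta\to\mathcal D^2_{\lambda,\mu}$ is conformally equivariant if $\mathcal Q L_X^{\delta}=L_X^{\lambda,\mu}\mathcal Q$ for all $X\in\mathrm o(p+1,q+1)$. It preserves the principal symbol if, for every $k\in\{0,1,2\}$ and every symbol $P$ of degree at most $k$, the operator $\mathcal Q(P)$ has order at most $k$ and its coefficients of order $k$ are the $P_k$. It is local if, whenever $P$ vanishes on an open set $W\subset U$, all functions $\mathcal Q(P)f$, $f\in C^\infty(U)$, vanish on $W$. **Theorem.** Assume $$\delta\notin\Big\{\tfrac2n,\ \tfrac{n+2}{2n},\ 1,\ \tfrac{n+1}n,\ \tfrac{n+2}n\Big\}.$$ Then there is a conformally equivariant linear isomorphism $\mathcal Q_{\lambda,\mu}:\mathcal S^2_\delta\to\mathcal D^2_{\lambda,\mu}$ that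 preserves the principal symbol. It is local, and it is given by $\mathcal Q_{\lambda,\mu}(P)=A_2^{ij}\partial_i\partial_j+A_1^i\partial_i+A_0$ with $$A_2^{ij}=P_2^{ij},\qquad A_1^i=P_1^i+\beta_1\,\partial_jP_2^{ij}+\beta_2\,g^{ij}g_{k\ell}\,\partial_jP_2^{k\ell},$$ $$A_0=P_0+\alpha\,\partial_iP_1^i+\beta_3\,\partial_i\partial_jP_2^{ij}+\beta_4\,g^{ij}g_{k\ell}\,\partial_i\partial_jP_2^{k\ell},$$ where $$\alpha=\frac{\lambda}{1-\delta},\qquad \beta_1=\frac{2(n\lambda+1)}{2+n(1-\delta)},\qquad \beta_2=\frac{n(\lambda+\mu-1)}{(2+n(1-\delta))(2-n\delta)},\qquad \beta_3=\frac{n\lambda(n\lambda+1)}{(1+n(1-\delta))(2+n(1-\delta))},$$ $$\beta_4=\frac{n\lambda\big(n^2\mu(2-\lambda-\mu)+2(n\lambda+1)^2-n(n+1)\big)}{(1+n(1-\delta))(2+n(1-\delta))(2+n(1-2\delta))(2-n\delta)}.$$ It is unique: every conformally equivariant linear map $\mathcal S^2_\delta\to\mathcal D^2_{\lambda,\mu}$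 that preserves the principal symbol and is local equals $\mathcal Q_{\lambda,\mu}$. If $U$ is convex (for example $U=\mathbb R^n$), locality need not be assumed. -/

import Mathlib

open scoped ContDiff

noncomputable section

namespace ConfQuant

/-- Index set of the coordinates `x¹, …, xⁿ`, `n = p + q`. -/
abbrev Idx (p q : ℕ) : Type := Fin p ⊕ Fin q

/-- The coordinate space `ℝⁿ`, `n = p + q`. -/
abbrev Coord (p q : ℕ) : Type := Idx p q → ℝ

/-- The diagonal entries of the flat metric `g = diag(1, …, 1, -1, …, -1)` (with `p` entries `1` and
`q` entries `-1`); `g` is its own inverse. -/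
def metric (𝕜 : Type*) [RCLike 𝕜] (p q : ℕ) : Idx p q → 𝕜 := Sum.elim (fun _ => 1) (fun _ => -1)

/-- Extension by zero to `ℝⁿ` of a function on the open set `U`. -/
def extend {𝕜 : Type*} [RCLike 𝕜] {p q : ℕ} (U : TopologicalSpace.Opens (Coord p q))
    (f : U → 𝕜) : Coord p q → 𝕜 :=
  Function.extend Subtype.val f 0

theorem extend_apply {𝕜 : Type*} [RCLike 𝕜] {p q : ℕ} (U : TopologicalSpace.Opens (Coord p q))
    (f : U → 𝕜) (x : U) : extend U f x = f x :=
  Subtype.val_injective.extend_apply f 0 x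

theorem contDiffOn_extend {𝕜 : Type*} [RCLike 𝕜] {p q : ℕ} (U : TopologicalSpace.Opens (Coord p q))
    (f : U → 𝕜) (F : Coord p q → 𝕜) (hF : ContDiffOn ℝ ∞ F U) (h : ∀ x : U, F x = f x) :
    ContDiffOn ℝ ∞ (extend U f) U :=
  hF.congr fun x hx => by rw [extend_apply U f ⟨x, hx⟩]; exact (h ⟨x, hx⟩).symm

/-- The algebra `C^∞(U)` of smooth `𝕜`-valued functions on the open set `U` (`𝕜 = ℝ` or `ℂ`). -/
def Smooth (𝕜 : Type*) [RCLike 𝕜] {p q : ℕ} (U : TopologicalSpace.Opens (Coord p q)) :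
    Subalgebra 𝕜 (U → 𝕜) where
  carrier := {f | ContDiffOn ℝ ∞ (extend U f) U}
  mul_mem' {f h} hf hh := contDiffOn_extend U _ _ (ContDiffOn.mul hf hh) fun x => by
    simp [extend_apply]
  add_mem' {f h} hf hh := contDiffOn_extend U _ _ (ContDiffOn.add hf hh) fun x => by
    simp [extend_apply]
  algebraMap_mem' c := contDiffOn_extend U _ (fun _ => c) contDiffOn_const fun x => by
    simp

section Local

variable {𝕜 : Type*} [RCLike 𝕜] {p q : ℕ} {U : TopologicalSpace.Opens (Coord p q)}

theorem differentiableAt_extend (f : Smooth 𝕜 U) (x : U) :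
    DifferentiableAt ℝ (extend U (f : U → 𝕜)) x :=
  (ContDiffOn.contDiffAt f.2 (U.isOpen.mem_nhds x.2)).differentiableAt (by simp)

/-- The partial derivative `∂ᵢ = ∂/∂xⁱ`, as a derivation of `C^∞(U)`. -/
def pd (𝕜 : Type*) [RCLike 𝕜] {p q : ℕ} (U : TopologicalSpace.Opens (Coord p q))
    (i : Idx p q) : Derivation 𝕜 (Smooth 𝕜 U) (Smooth 𝕜 U) :=
  Derivation.mk'
    { toFun := fun f => ⟨fun x => fderiv ℝ (extend U (f : U → 𝕜)) x (Pi.single i 1), by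
        refine contDiffOn_extend U _
          (fun x => fderiv ℝ (extend U (f : U → 𝕜)) x (Pi.single i 1)) ?_ fun x => rfl
        exact (ContDiffOn.fderiv_of_isOpen (m := ∞) f.2 U.isOpen (by simp)).clm_apply
          contDiffOn_const⟩
      map_add' := fun f h => by
        ext x
        have e : extend U (f + h : U → 𝕜) =ᶠ[nhds (x : Coord p q)]
            fun y => extend U (f : U → 𝕜) y + extend U (h : U → 𝕜) y := by
          filter_upwards [U.isOpen.mem_nhds x.2] with y hy
          simp [extend_apply U _ ⟨y, hy⟩]
        simp [e.fderiv_eq, fderiv_fun_add (differentiableAt_extend f x)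
          (differentiableAt_extend h x)]
      map_smul' := fun c f => by
        ext x
        have e : extend U (c • f : U → 𝕜) =ᶠ[nhds (x : Coord p q)]
            fun y => c • extend U (f : U → 𝕜) y := by
          filter_upwards [U.isOpen.mem_nhds x.2] with y hy
          simp [extend_apply U _ ⟨y, hy⟩]
        have := fderiv_fun_const_smul (differentiableAt_extend f x) c
        simp only [smul_eq_mul] at this e
        simp [e.fderiv_eq, this] }
    (fun f h => by
      ext x
      have e : extend U (f * h : U → 𝕜) =ᶠ[nhds (x : Coord p q)]
          fun y => extend U (f : U → 𝕜) y * extend U (h : U → 𝕜) y := by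
        filter_upwards [U.isOpen.mem_nhds x.2] with y hy
        simp [extend_apply U _ ⟨y, hy⟩]
      simp [e.fderiv_eq, fderiv_fun_mul (differentiableAt_extend f x)
        (differentiableAt_extend h x), extend_apply])

/-- The coordinate function `xⁱ`. -/
def coord (i : Idx p q) : Smooth 𝕜 U :=
  ⟨fun x => ((x : Coord p q) i : 𝕜),
    contDiffOn_extend U _ (fun x => ((x i : ℝ) : 𝕜))
      ((RCLike.ofRealCLM (K := 𝕜)).contDiff.comp (contDiff_apply ℝ ℝ i)).contDiffOn fun _ => rfl⟩

end Local

variable (𝕜 : Type*) [RCLike 𝕜] {p q : ℕ} (U : TopologicalSpace.Opens (Coord p q))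

/-- Vector fields `X = Xⁱ ∂ᵢ` on `U`, given by their components. -/
abbrev VField : Type _ := Idx p q → Smooth 𝕜 U

/-- `X_i = ∂/∂xⁱ`. -/
def translation (i : Idx p q) : VField 𝕜 U := Pi.single i 1

/-- `X_ij = x_i ∂/∂xʲ - x_j ∂/∂xⁱ`, where `x_i = g_ij xʲ`. -/
def rotation (i j : Idx p q) : VField 𝕜 U :=
  Pi.single j (metric 𝕜 p q i • coord i) - Pi.single i (metric 𝕜 p q j • coord j)

/-- `X_0 = xⁱ ∂/∂xⁱ`. -/
def homothety : VField 𝕜 U := fun k => coord k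

/-- `X̄_i = x_j xʲ ∂/∂xⁱ - 2 x_i xʲ ∂/∂xʲ`. -/
def inversion (i : Idx p q) : VField 𝕜 U :=
  Pi.single i (∑ j, metric 𝕜 p q j • (coord j * coord j))
    - fun j => (2 * metric 𝕜 p q i) • (coord i * coord j)

/-- The conformal Lie algebra `o(p+1,q+1)` of vector fields on `U`. The real span of the generators
is closed under the Lie bracket. -/
def confAlg : Submodule ℝ (VField 𝕜 U) :=
  Submodule.span ℝ (Set.range (translation 𝕜 U)
    ∪ Set.range (fun ij : Idx p q × Idx p q => rotation 𝕜 U ij.1 ij.2)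
    ∪ {homothety 𝕜 U} ∪ Set.range (inversion 𝕜 U))

/-- The module `S²` of symbols `P(ξ) = P₂^{ij} ξ_i ξ_j + P₁^i ξ_i + P₀` of degree at most two, i.e.
of triples `(P₂, P₁, P₀)` of contravariant symmetric tensor fields with smooth components. -/
def Symb : Submodule 𝕜
    ((Idx p q → Idx p q → Smooth 𝕜 U) × (Idx p q → Smooth 𝕜 U) × Smooth 𝕜 U) where
  carrier := {P | ∀ i j, P.1 i j = P.1 j i}
  add_mem' ha hb i j := by simp [ha i j, hb i j]
  zero_mem' i j := rfl
  smul_mem' c P h i j := by simp [h i j]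

section Actions

variable {𝕜 U}

/-- The quadratic part `P₂^{ij}` of a symbol. -/
def c2 (P : Symb 𝕜 U) : Idx p q → Idx p q → Smooth 𝕜 U := P.1.1

/-- The linear part `P₁^i` of a symbol. -/
def c1 (P : Symb 𝕜 U) : Idx p q → Smooth 𝕜 U := P.1.2.1

/-- The part `P₀` of degree zero of a symbol. -/
def c0 (P : Symb 𝕜 U) : Smooth 𝕜 U := P.1.2.2

/-- The divergence `Div X = ∂ᵢ Xⁱ`. -/
def divergence (X : VField 𝕜 U) : Smooth 𝕜 U := ∑ i, pd 𝕜 U i (X i)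

/-- The Lie derivative `L_X^w f = Xⁱ ∂ᵢ f + w Div(X) f` of densities of degree `w`. -/
def lieDensity (w : 𝕜) (X : VField 𝕜 U) : Module.End 𝕜 (Smooth 𝕜 U) :=
  (∑ i, LinearMap.mulLeft 𝕜 (X i) ∘ₗ (pd 𝕜 U i).toLinearMap)
    + w • LinearMap.mulLeft 𝕜 (divergence X)

/-- The action `L_X^{λ,μ} A = L_X^μ A - A L_X^λ` on operators from `λ`-densities to `μ`-densities. -/
def lieOp (lam mu : 𝕜) (X : VField 𝕜 U) (A : Module.End 𝕜 (Smooth 𝕜 U)) :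
    Module.End 𝕜 (Smooth 𝕜 U) :=
  lieDensity mu X ∘ₗ A - A ∘ₗ lieDensity lam X

/-- The action `L_X^δ P = L_X P + δ Div(X) P` on symbols, where
`L_X = Xᵏ ∂/∂xᵏ - ξ_j ∂_k Xʲ ∂/∂ξ_k`, in components. -/
def lieSymb (δ : 𝕜) (X : VField 𝕜 U) (P : Symb 𝕜 U) : Symb 𝕜 U :=
  ⟨(fun i j => lieDensity δ X (c2 P i j)
        - ∑ k, (pd 𝕜 U k (X i) * c2 P k j + pd 𝕜 U k (X j) * c2 P i k),
    fun i => lieDensity δ X (c1 P i) - ∑ k, pd 𝕜 U k (X i) * c1 P k,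
    lieDensity δ X (c0 P)), fun i j => by
      have h : ∀ a b, c2 P a b = c2 P b a := P.2
      simp only [h i j]
      congr 1
      refine Finset.sum_congr rfl fun k _ => ?_
      rw [h k j, h i k, add_comm]⟩

/-- The differential operator `A₂^{ij} ∂ᵢ ∂ⱼ + A₁^i ∂ᵢ + A₀` with coefficients `A`. -/
def op : Symb 𝕜 U →ₗ[𝕜] Module.End 𝕜 (Smooth 𝕜 U) :=
  LinearMap.mk₂ 𝕜
    (fun A f => (∑ i, ∑ j, c2 A i j * pd 𝕜 U i (pd 𝕜 U j f)) + (∑ i, c1 A i * pd 𝕜 U i f)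
      + c0 A * f)
    (fun A B f => by
      have h2 : ∀ i j, c2 (A + B) i j = c2 A i j + c2 B i j := fun _ _ => rfl
      have h1 : ∀ i, c1 (A + B) i = c1 A i + c1 B i := fun _ => rfl
      have h0 : c0 (A + B) = c0 A + c0 B := rfl
      simp only [h2, h1, h0, add_mul, Finset.sum_add_distrib]
      abel)
    (fun c A f => by
      have h2 : ∀ i j, c2 (c • A) i j = c • c2 A i j := fun _ _ => rfl
      have h1 : ∀ i, c1 (c • A) i = c • c1 A i := fun _ => rfl
      have h0 : c0 (c • A) = c • c0 A := rfl
      simp only [h2, h1, h0, smul_mul_assoc, Finset.smul_sum, smul_add])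
    (fun A f h => by
      simp only [map_add, mul_add, Finset.sum_add_distrib]
      abel)
    (fun c A f => by
      simp only [Derivation.map_smul, mul_smul_comm, Finset.smul_sum, smul_add])

end Actions

/-- The module `D²` of differential operators of order at most two, with smooth coefficients,
acting on densities on `U`; densities are identified with functions by means of the volume form
`dx¹ ∧ ⋯ ∧ dxⁿ`. -/
abbrev DiffOp2 : Submodule 𝕜 (Module.End 𝕜 (Smooth 𝕜 U)) := LinearMap.range (op (𝕜 := 𝕜) (U := U))

/-- The symbols of degree less than `k` (at most two). -/
def symbLT (k : ℕ) : Set (Symb 𝕜 U) :=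
  {P | (k ≤ 2 → c2 P = 0) ∧ (k ≤ 1 → c1 P = 0) ∧ (k ≤ 0 → c0 P = 0)}

section Maps

variable {𝕜 U}

/-- `Q` intertwines the actions of the conformal Lie algebra on `S²_δ`, `δ = μ - λ`, and on
`D²_{λ,μ}`. -/
def ConfEquivariant (lam mu : 𝕜) (Q : Symb 𝕜 U →ₗ[𝕜] DiffOp2 𝕜 U) : Prop :=
  ∀ X ∈ confAlg 𝕜 U, ∀ P : Symb 𝕜 U,
    (Q (lieSymb (mu - lam) X P) : Module.End 𝕜 (Smooth 𝕜 U)) = lieOp lam mu X (Q P)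

/-- `Q` preserves the principal symbol at each order: for `P` of degree at most `k`, the operator
`Q P` agrees up to operators of order less than `k` with the operator whose coefficients are those
of `P`, i.e. it has order at most `k` and its `k`-th order coefficients are those of `P`. -/
def PreservesPrincipalSymbol (Q : Symb 𝕜 U →ₗ[𝕜] DiffOp2 𝕜 U) : Prop :=
  ∀ (k : ℕ), ∀ P ∈ symbLT 𝕜 U (k + 1), ∃ B ∈ symbLT 𝕜 U k,
    (Q P : Module.End 𝕜 (Smooth 𝕜 U)) = op P + op B

/-- `Q` is local: wherever a symbol vanishes on an open set, so does its image. -/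
def IsLocalMap (Q : Symb 𝕜 U →ₗ[𝕜] DiffOp2 𝕜 U) : Prop :=
  ∀ (W : Set U), IsOpen W → ∀ P : Symb 𝕜 U,
    (∀ x ∈ W, (∀ i j, (c2 P i j : U → 𝕜) x = 0) ∧ (∀ i, (c1 P i : U → 𝕜) x = 0) ∧
      (c0 P : U → 𝕜) x = 0) →
    ∀ f : Smooth 𝕜 U, ∀ x ∈ W, ((Q P : Module.End 𝕜 (Smooth 𝕜 U)) f : U → 𝕜) x = 0

end Maps

end ConfQuant

end

open scoped ContDiff

noncomputable section

namespace ConfQuant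

/-! ### Partial derivatives of smooth functions on `U` -/

variable {𝕜 : Type*} [RCLike 𝕜] {p q : ℕ} {U : TopologicalSpace.Opens (Coord p q)}

/-! An operator is determined by its coefficients (`op_injective`), so the whole problem can be
moved to `Symb`. There the action on operators is `lieSymb` minus `opDefect`, a correction built
from second derivatives of X and derivatives of Div X only (`lieOp_op`).

Existence. Every X in the conformal algebra satisfies L_X g = 2φg with ∂∂φ = 0
(`exists_isConformal`); the second condition is not automatic in dimension at most two. Hence Div X
= nφ, and the second derivatives of X are combinations of the ∂φ (`IsConformal.pd_pd_field`). Both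
`opDefect` and the failure of the divergence and of the gradient of the trace to commute with L_X
become contractions with ∂φ. Equivariance of 1 + `quantLower` thus amounts to matching the
coefficients of five contractions, which gives five linear equations, triangular in α, β₁, β₂, β₃,
β₄ (`IsConformal.quantEquiv_lieSymb`); the stated coefficients solve them. Since `quantLower` lowers
the degree it is nilpotent, and 1 + `quantLower` is bijective.

Uniqueness. If Q' is another quantization, M = Q⁻¹Q' commutes with the conformal algebra and M - 1
lowers the degree. A linear map commuting with the generators commutes with the Casimir operator
(`map_casimir`). On symbols this operator is algebraic: scalar in degrees 0 and 1, with one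
eigenvalue on trace-free and one on pure-trace symbols in degree 2 (`c0_symbCasimir`,
`c1_symbCasimir`, `c2_symbCasimir`). The five differences between eigenvalues of different degrees
vanish exactly at the five excluded values of δ, so M - 1 has nowhere to map to and is zero
(`eq_zero_of_symbLT`). -/

theorem pd_apply (i : Idx p q) (f : Smooth 𝕜 U) (x : U) :
    (pd 𝕜 U i f : U → 𝕜) x = fderiv ℝ (extend U (f : U → 𝕜)) x (Pi.single i 1) := rfl

theorem fderiv_extend_pd (j : Idx p q) (f : Smooth 𝕜 U) (x : U) (v : Coord p q) :
    fderiv ℝ (extend U (pd 𝕜 U j f : U → 𝕜)) x v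
      = fderiv ℝ (fderiv ℝ (extend U (f : U → 𝕜))) x v (Pi.single j 1) := by
  have e : extend U (pd 𝕜 U j f : U → 𝕜) =ᶠ[nhds (x : Coord p q)]
      fun y => fderiv ℝ (extend U (f : U → 𝕜)) y (Pi.single j 1) := by
    filter_upwards [U.isOpen.mem_nhds x.2] with y hy
    rw [extend_apply U _ ⟨y, hy⟩, pd_apply]
  have hd : DifferentiableAt ℝ (fderiv ℝ (extend U (f : U → 𝕜))) (x : Coord p q) :=
    (((ContDiffOn.contDiffAt f.2 (U.isOpen.mem_nhds x.2)).fderiv_right (m := 1)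
      (by norm_cast)).differentiableAt (by simp))
  rw [e.fderiv_eq, fderiv_clm_apply hd (differentiableAt_const _)]
  simp

/-- Partial derivatives commute. -/
theorem pd_comm (i j : Idx p q) (f : Smooth 𝕜 U) :
    pd 𝕜 U i (pd 𝕜 U j f) = pd 𝕜 U j (pd 𝕜 U i f) := by
  ext x
  rw [pd_apply, pd_apply, fderiv_extend_pd, fderiv_extend_pd]
  refine (ContDiffAt.isSymmSndFDerivAt (n := ∞)
    (ContDiffOn.contDiffAt f.2 (U.isOpen.mem_nhds x.2)) ?_) _ _
  simpa using WithTop.coe_le_coe.2 (le_top : (2 : ℕ∞) ≤ ⊤)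

theorem pd_coord (i j : Idx p q) :
    pd 𝕜 U i (coord j) = if i = j then 1 else 0 := by
  ext x
  have e : extend U ((coord j : Smooth 𝕜 U) : U → 𝕜) =ᶠ[nhds (x : Coord p q)]
      fun y => (RCLike.ofRealCLM (K := 𝕜)) (ContinuousLinearMap.proj (R := ℝ) j y) := by
    filter_upwards [U.isOpen.mem_nhds x.2] with y hy
    rw [extend_apply U _ ⟨y, hy⟩]; rfl
  rw [pd_apply, e.fderiv_eq]
  rw [show (fun y : Coord p q => (RCLike.ofRealCLM (K := 𝕜)) (ContinuousLinearMap.proj (R := ℝ) j y))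
    = ((RCLike.ofRealCLM (K := 𝕜)).comp (ContinuousLinearMap.proj (R := ℝ) j) :
      Coord p q → 𝕜) from rfl, ContinuousLinearMap.fderiv]
  by_cases h : i = j
  · subst h; simp
  · simp [h, Ne.symm h]

theorem pd_eq_zero_of_eqOn {W : Set U} (hW : IsOpen W) {f : Smooth 𝕜 U}
    (hf : ∀ x ∈ W, (f : U → 𝕜) x = 0) (i : Idx p q) :
    ∀ x ∈ W, (pd 𝕜 U i f : U → 𝕜) x = 0 := by
  intro x hx
  have e : extend U (f : U → 𝕜) =ᶠ[nhds (x : Coord p q)] fun _ => 0 := by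
    filter_upwards [(U.isOpen.isOpenMap_subtype_val W hW).mem_nhds ⟨x, hx, rfl⟩]
    rintro _ ⟨y, hy, rfl⟩
    rw [extend_apply, hf y hy]
  rw [pd_apply, e.fderiv_eq]
  simp

/-! ### Operators and their coefficients -/

theorem lieDensity_apply (w : 𝕜) (X : VField 𝕜 U) (f : Smooth 𝕜 U) :
    lieDensity w X f = ∑ i, X i * pd 𝕜 U i f + w • (divergence X * f) := by
  simp [lieDensity, LinearMap.sum_apply]

theorem op_apply (A : Symb 𝕜 U) (f : Smooth 𝕜 U) :
    op A f = (∑ i, ∑ j, c2 A i j * pd 𝕜 U i (pd 𝕜 U j f)) + (∑ i, c1 A i * pd 𝕜 U i f)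
      + c0 A * f := rfl

theorem symb_ext {A B : Symb 𝕜 U} (h2 : ∀ i j, c2 A i j = c2 B i j) (h1 : ∀ i, c1 A i = c1 B i)
    (h0 : c0 A = c0 B) : A = B :=
  Subtype.ext (Prod.ext (funext fun i => funext fun j => h2 i j) (Prod.ext (funext h1) h0))

theorem c2_symm (A : Symb 𝕜 U) (i j : Idx p q) : c2 A i j = c2 A j i := A.2 i j

theorem pd_pd_coord (i j k : Idx p q) : pd 𝕜 U i (pd 𝕜 U j (coord k)) = 0 := by
  rw [pd_coord]
  split_ifs <;> simp

theorem pd_pd_coord_mul_coord (i j k l : Idx p q) :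
    pd 𝕜 U k (pd 𝕜 U l (coord i * coord j))
      = (if l = j then if k = i then 1 else 0 else 0)
        + (if l = i then if k = j then 1 else 0 else 0) := by
  simp only [Derivation.leibniz, smul_eq_mul, map_add, pd_pd_coord, mul_zero, zero_add]
  simp only [pd_coord, mul_ite, mul_one, mul_zero]
  split_ifs <;> simp

/-- Applying the operator to 1, xⁱ and xⁱxʲ recovers the coefficients of order 0, 1 and 2 in turn;
symmetry of the quadratic part is needed for the last. -/
theorem op_injective : Function.Injective (op (𝕜 := 𝕜) (U := U)) := by
  rw [injective_iff_map_eq_zero]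
  intro A hA
  have h0 : c0 A = 0 := by
    have := LinearMap.congr_fun hA 1
    simpa [op_apply] using this
  have h1 : ∀ i, c1 A i = 0 := fun i => by
    have := LinearMap.congr_fun hA (coord i)
    simpa [op_apply, h0, pd_coord, apply_ite] using this
  refine symb_ext (fun i j => ?_) h1 h0
  have := LinearMap.congr_fun hA (coord i * coord j)
  simp only [op_apply, h0, h1, zero_mul, Finset.sum_const_zero, add_zero, LinearMap.zero_apply,
    pd_pd_coord_mul_coord, mul_add, mul_ite, mul_one, mul_zero, Finset.sum_add_distrib,
    Finset.sum_ite_eq', Finset.mem_univ, if_true] at this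
  rw [c2_symm A j i, ← two_mul] at this
  have h2 : ((2 : 𝕜) • c2 A i j) = 0 := by
    rw [two_smul, ← two_mul, this]
  exact (smul_eq_zero.1 h2).resolve_left two_ne_zero

/-! ### Lie derivatives and the defect of the total symbol map -/

theorem sum_comm_fst_trd {ι M : Type*} [Fintype ι] [AddCommMonoid M] (F : ι → ι → ι → M) :
    ∑ i, ∑ j, ∑ k, F i j k = ∑ i, ∑ j, ∑ k, F k j i := by
  rw [Finset.sum_comm, Finset.sum_comm (f := fun i j => ∑ k, F k j i)]
  exact Finset.sum_congr rfl fun j _ => Finset.sum_comm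

theorem sum_comm_snd_trd {ι M : Type*} [Fintype ι] [AddCommMonoid M] (F : ι → ι → ι → M) :
    ∑ i, ∑ j, ∑ k, F i j k = ∑ i, ∑ j, ∑ k, F i k j :=
  Finset.sum_congr rfl fun _ _ => Finset.sum_comm

theorem lieDensity_mul (w w' : 𝕜) (X : VField 𝕜 U) (a b : Smooth 𝕜 U) :
    lieDensity (w' + w) X (a * b) = lieDensity w' X a * b + a * lieDensity w X b := by
  simp only [lieDensity_apply, Derivation.leibniz, smul_eq_mul, mul_add, add_mul,
    Finset.sum_add_distrib, Finset.sum_mul, Finset.mul_sum, add_smul, smul_mul_assoc,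
    mul_smul_comm]
  have e1 : ∑ i, X i * (a * pd 𝕜 U i b) = ∑ i, a * (X i * pd 𝕜 U i b) :=
    Finset.sum_congr rfl fun i _ => by ring
  have e2 : ∑ i, X i * (b * pd 𝕜 U i a) = ∑ i, X i * pd 𝕜 U i a * b :=
    Finset.sum_congr rfl fun i _ => by ring
  rw [e1, e2, show divergence X * (a * b) = a * (divergence X * b) by ring,
    show divergence X * a * b = a * (divergence X * b) by ring]
  abel

theorem pd_lieDensity (w : 𝕜) (X : VField 𝕜 U) (i : Idx p q) (f : Smooth 𝕜 U) :
    pd 𝕜 U i (lieDensity w X f) = lieDensity w X (pd 𝕜 U i f)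
      + ∑ k, pd 𝕜 U i (X k) * pd 𝕜 U k f + w • (pd 𝕜 U i (divergence X) * f) := by
  simp only [lieDensity_apply, map_add, map_sum, Derivation.map_smul, Derivation.leibniz,
    smul_eq_mul, Finset.sum_add_distrib, smul_add]
  have e1 : ∑ k, X k * pd 𝕜 U i (pd 𝕜 U k f) = ∑ k, X k * pd 𝕜 U k (pd 𝕜 U i f) :=
    Finset.sum_congr rfl fun k _ => by rw [pd_comm]
  have e2 : ∑ k, pd 𝕜 U k f * pd 𝕜 U i (X k) = ∑ k, pd 𝕜 U i (X k) * pd 𝕜 U k f :=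
    Finset.sum_congr rfl fun k _ => mul_comm _ _
  rw [e1, e2, mul_comm f]
  abel

theorem pd_pd_lieDensity (w : 𝕜) (X : VField 𝕜 U) (i j : Idx p q) (f : Smooth 𝕜 U) :
    pd 𝕜 U i (pd 𝕜 U j (lieDensity w X f)) = lieDensity w X (pd 𝕜 U i (pd 𝕜 U j f))
      + ∑ k, pd 𝕜 U i (X k) * pd 𝕜 U k (pd 𝕜 U j f)
      + ∑ k, pd 𝕜 U j (X k) * pd 𝕜 U i (pd 𝕜 U k f)
      + ∑ k, pd 𝕜 U i (pd 𝕜 U j (X k)) * pd 𝕜 U k f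
      + w • (pd 𝕜 U i (divergence X) * pd 𝕜 U j f)
      + w • (pd 𝕜 U j (divergence X) * pd 𝕜 U i f)
      + w • (pd 𝕜 U i (pd 𝕜 U j (divergence X)) * f) := by
  rw [pd_lieDensity, map_add, map_add, pd_lieDensity, map_sum, Derivation.map_smul]
  simp only [Derivation.leibniz, smul_eq_mul, Finset.sum_add_distrib, smul_add]
  have e1 : ∑ k, pd 𝕜 U k f * pd 𝕜 U i (pd 𝕜 U j (X k))
      = ∑ k, pd 𝕜 U i (pd 𝕜 U j (X k)) * pd 𝕜 U k f :=
    Finset.sum_congr rfl fun k _ => mul_comm _ _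
  rw [e1, mul_comm f]
  abel

/-- The defect of the total symbol map `op` to intertwine the actions of a vector field on symbols
and on operators. -/
def opDefect (lam : 𝕜) (X : VField 𝕜 U) (A : Symb 𝕜 U) : Symb 𝕜 U :=
  ⟨(0, fun i => ∑ j, ∑ k, c2 A j k * pd 𝕜 U j (pd 𝕜 U k (X i))
      + (2 * lam) • ∑ j, c2 A i j * pd 𝕜 U j (divergence X),
    lam • ∑ i, ∑ j, c2 A i j * pd 𝕜 U i (pd 𝕜 U j (divergence X))
      + lam • ∑ i, c1 A i * pd 𝕜 U i (divergence X)), fun _ _ => rfl⟩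

-- By the Leibniz rule for weights, only the commutators of ∂ᵢ and ∂ᵢ∂ⱼ with L_X^λ matter. Their
-- terms with first derivatives of X build the tensorial action on symbols; the remaining terms are
-- the defect.
set_option maxHeartbeats 1000000 in
theorem lieOp_op (lam mu : 𝕜) (X : VField 𝕜 U) (A : Symb 𝕜 U) :
    lieOp lam mu X (op A) = op (lieSymb (mu - lam) X A - opDefect lam X A) := by
  refine LinearMap.ext fun f => ?_
  -- Splitting the weight as μ = δ + λ gives the coefficient the weight δ and the derivatives of f
  -- the weight λ.
  have hmu : ∀ a b : Smooth 𝕜 U, lieDensity mu X (a * b)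
      = lieDensity (mu - lam) X a * b + a * lieDensity lam X b := fun a b => by
    rw [← lieDensity_mul, sub_add_cancel]
  have d2 : ∀ i j, c2 (lieSymb (mu - lam) X A - opDefect lam X A) i j
      = lieDensity (mu - lam) X (c2 A i j)
        - ∑ k, (pd 𝕜 U k (X i) * c2 A k j + pd 𝕜 U k (X j) * c2 A i k) := fun i j =>
    sub_zero _
  have d1 : ∀ i, c1 (lieSymb (mu - lam) X A - opDefect lam X A) i
      = lieDensity (mu - lam) X (c1 A i) - ∑ k, pd 𝕜 U k (X i) * c1 A k
        - (∑ j, ∑ k, c2 A j k * pd 𝕜 U j (pd 𝕜 U k (X i))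
          + (2 * lam) • ∑ j, c2 A i j * pd 𝕜 U j (divergence X)) := fun i => rfl
  have d0 : c0 (lieSymb (mu - lam) X A - opDefect lam X A)
      = lieDensity (mu - lam) X (c0 A)
        - (lam • ∑ i, ∑ j, c2 A i j * pd 𝕜 U i (pd 𝕜 U j (divergence X))
          + lam • ∑ i, c1 A i * pd 𝕜 U i (divergence X)) := rfl
  have hL : lieOp lam mu X (op A) f = lieDensity mu X (op A f) - op A (lieDensity lam X f) := rfl
  rw [hL, op_apply, op_apply, op_apply]
  simp only [pd_pd_lieDensity]
  simp only [map_add, map_sum, hmu, d2, d1, d0, pd_lieDensity]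
  simp only [mul_add, add_mul, sub_mul, Finset.sum_add_distrib, Finset.sum_sub_distrib,
    Finset.mul_sum, Finset.sum_mul, mul_smul_comm, smul_mul_assoc, ← Finset.smul_sum]
  have e1 : ∑ i, ∑ j, ∑ k, pd 𝕜 U k (X i) * c2 A k j * pd 𝕜 U i (pd 𝕜 U j f)
      = ∑ i, ∑ j, ∑ k, c2 A i j * (pd 𝕜 U i (X k) * pd 𝕜 U k (pd 𝕜 U j f)) := by
    rw [sum_comm_fst_trd]
    refine Finset.sum_congr rfl fun i _ => Finset.sum_congr rfl fun j _ =>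
      Finset.sum_congr rfl fun k _ => by ring
  have e2 : ∑ i, ∑ j, ∑ k, pd 𝕜 U k (X j) * c2 A i k * pd 𝕜 U i (pd 𝕜 U j f)
      = ∑ i, ∑ j, ∑ k, c2 A i j * (pd 𝕜 U j (X k) * pd 𝕜 U i (pd 𝕜 U k f)) := by
    rw [sum_comm_snd_trd]
    refine Finset.sum_congr rfl fun i _ => Finset.sum_congr rfl fun j _ =>
      Finset.sum_congr rfl fun k _ => by ring
  have e3 : ∑ i, ∑ j, ∑ k, c2 A j k * pd 𝕜 U j (pd 𝕜 U k (X i)) * pd 𝕜 U i f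
      = ∑ i, ∑ j, ∑ k, c2 A i j * (pd 𝕜 U i (pd 𝕜 U j (X k)) * pd 𝕜 U k f) := by
    rw [sum_comm_fst_trd, sum_comm_fst_trd, sum_comm_snd_trd, sum_comm_fst_trd]
    refine Finset.sum_congr rfl fun i _ => Finset.sum_congr rfl fun j _ =>
      Finset.sum_congr rfl fun k _ => by ring
  have e4 : ∑ i, ∑ j, c2 A i j * pd 𝕜 U j (divergence X) * pd 𝕜 U i f
      = ∑ i, ∑ j, c2 A i j * (pd 𝕜 U j (divergence X) * pd 𝕜 U i f) := by
    refine Finset.sum_congr rfl fun i _ => Finset.sum_congr rfl fun j _ => by ring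
  have e5 : ∑ i, ∑ j, c2 A i j * (pd 𝕜 U i (divergence X) * pd 𝕜 U j f)
      = ∑ i, ∑ j, c2 A i j * (pd 𝕜 U j (divergence X) * pd 𝕜 U i f) := by
    rw [Finset.sum_comm]
    refine Finset.sum_congr rfl fun i _ => Finset.sum_congr rfl fun j _ => by
      rw [c2_symm A i j]
  have e6 : ∑ i, ∑ j, c2 A i j * pd 𝕜 U i (pd 𝕜 U j (divergence X)) * f
      = ∑ i, ∑ j, c2 A i j * (pd 𝕜 U i (pd 𝕜 U j (divergence X)) * f) := by
    refine Finset.sum_congr rfl fun i _ => Finset.sum_congr rfl fun j _ => by ring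
  have e7 : ∑ i, ∑ k, pd 𝕜 U k (X i) * c1 A k * pd 𝕜 U i f
      = ∑ i, ∑ k, c1 A i * (pd 𝕜 U i (X k) * pd 𝕜 U k f) := by
    rw [Finset.sum_comm]
    refine Finset.sum_congr rfl fun i _ => Finset.sum_congr rfl fun j _ => by ring
  have e8 : ∑ i, c1 A i * pd 𝕜 U i (divergence X) * f
      = ∑ i, c1 A i * (pd 𝕜 U i (divergence X) * f) := by
    refine Finset.sum_congr rfl fun i _ => by ring
  rw [e1, e2, e3, e4, e5, e6, e7, e8, mul_smul, two_smul]
  abel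

/-! ### Conformal Killing fields and their action on traces, divergences and gradients -/

theorem metric_mul_self (i : Idx p q) : metric 𝕜 p q i * metric 𝕜 p q i = 1 := by
  rcases i with i | i <;> simp [metric]

theorem metric_smul_metric_smul {M : Type*} [AddCommGroup M] [Module 𝕜 M] (i : Idx p q) (m : M) :
    metric 𝕜 p q i • metric 𝕜 p q i • m = m := by
  rw [smul_smul, metric_mul_self, one_smul]

/-- `X` is a conformal Killing field of the flat metric, with conformal factor `φ` of degree at
most one. -/
structure IsConformal (X : VField 𝕜 U) (φ : Smooth 𝕜 U) : Prop where
  killing : ∀ i j, metric 𝕜 p q i • pd 𝕜 U j (X i) + metric 𝕜 p q j • pd 𝕜 U i (X j)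
    = if i = j then (2 * metric 𝕜 p q i) • φ else 0
  pd_pd : ∀ i j, pd 𝕜 U i (pd 𝕜 U j φ) = 0

/-- The trace `g_{kl} P₂^{kl}`. -/
def trace (P : Symb 𝕜 U) : Smooth 𝕜 U := ∑ k, metric 𝕜 p q k • c2 P k k

/-- The divergence `∂ⱼ P₂^{ij}`. -/
def div2 (P : Symb 𝕜 U) (i : Idx p q) : Smooth 𝕜 U := ∑ j, pd 𝕜 U j (c2 P i j)

/-- The Lie derivative of a vector density. -/
def lieVec (δ : 𝕜) (X : VField 𝕜 U) (W : VField 𝕜 U) : VField 𝕜 U :=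
  fun i => lieDensity δ X (W i) - ∑ k, pd 𝕜 U k (X i) * W k

/-- The divergence of a vector density of weight 1 is coordinate-free, so the correction carries the
factor δ - 1. -/
theorem divergence_lieVec (δ : 𝕜) (X W : VField 𝕜 U) :
    divergence (lieVec δ X W) = lieDensity δ X (divergence W)
      + (δ - 1) • ∑ i, pd 𝕜 U i (divergence X) * W i := by
  have hX : ∀ k, pd 𝕜 U k (divergence X) = ∑ i, pd 𝕜 U i (pd 𝕜 U k (X i)) := fun k => by
    rw [divergence, map_sum]
    exact Finset.sum_congr rfl fun i _ => pd_comm _ _ _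
  rw [divergence, divergence]
  simp only [lieVec, map_sub, map_sum, pd_lieDensity, Derivation.leibniz, smul_eq_mul,
    Finset.sum_add_distrib, Finset.sum_sub_distrib, ← Finset.smul_sum, sub_smul, one_smul]
  have e1 : ∑ i, ∑ k, pd 𝕜 U k (X i) * pd 𝕜 U i (W k)
      = ∑ i, ∑ k, pd 𝕜 U i (X k) * pd 𝕜 U k (W i) := by
    rw [Finset.sum_comm]
  have e2 : ∑ i, ∑ k, W k * pd 𝕜 U i (pd 𝕜 U k (X i)) = ∑ i, pd 𝕜 U i (divergence X) * W i := by
    rw [Finset.sum_comm]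
    refine Finset.sum_congr rfl fun k _ => ?_
    rw [hX, Finset.sum_mul]
    exact Finset.sum_congr rfl fun i _ => mul_comm _ _
  rw [e1, e2]
  abel

theorem div2_lieSymb (δ : 𝕜) (X : VField 𝕜 U) (P : Symb 𝕜 U) (i : Idx p q) :
    div2 (lieSymb δ X P) i = lieVec δ X (div2 P) i
      - ∑ j, ∑ k, c2 P j k * pd 𝕜 U j (pd 𝕜 U k (X i))
      + (δ - 1) • ∑ j, c2 P i j * pd 𝕜 U j (divergence X) := by
  have hX : ∀ k, pd 𝕜 U k (divergence X) = ∑ i, pd 𝕜 U i (pd 𝕜 U k (X i)) := fun k => by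
    rw [divergence, map_sum]
    exact Finset.sum_congr rfl fun i _ => pd_comm _ _ _
  have d2 : ∀ i j, c2 (lieSymb δ X P) i j = lieDensity δ X (c2 P i j)
      - ∑ k, (pd 𝕜 U k (X i) * c2 P k j + pd 𝕜 U k (X j) * c2 P i k) := fun _ _ => rfl
  simp only [div2, lieVec, d2, map_sub, map_sum, map_add, pd_lieDensity, Derivation.leibniz,
    smul_eq_mul, Finset.sum_add_distrib, Finset.sum_sub_distrib, ← Finset.smul_sum, sub_smul,
    one_smul, Finset.mul_sum]
  have e1 : ∑ j, ∑ k, pd 𝕜 U k (X j) * pd 𝕜 U j (c2 P i k)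
      = ∑ j, ∑ k, pd 𝕜 U j (X k) * pd 𝕜 U k (c2 P i j) := Finset.sum_comm
  have e2 : ∑ j, ∑ k, c2 P i k * pd 𝕜 U j (pd 𝕜 U k (X j))
      = ∑ j, c2 P i j * pd 𝕜 U j (divergence X) := by
    rw [Finset.sum_comm]
    refine Finset.sum_congr rfl fun k _ => ?_
    rw [hX, Finset.mul_sum]
  have e3 : ∑ j, ∑ k, pd 𝕜 U k (X i) * pd 𝕜 U j (c2 P k j)
      = ∑ k, ∑ j, pd 𝕜 U k (X i) * pd 𝕜 U j (c2 P k j) := Finset.sum_comm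
  have e4 : ∑ j, ∑ k, c2 P k j * pd 𝕜 U j (pd 𝕜 U k (X i))
      = ∑ j, ∑ k, c2 P j k * pd 𝕜 U j (pd 𝕜 U k (X i)) :=
    Finset.sum_congr rfl fun j _ => Finset.sum_congr rfl fun k _ => by rw [c2_symm]
  have e5 : ∑ j, pd 𝕜 U j (divergence X) * c2 P i j = ∑ j, c2 P i j * pd 𝕜 U j (divergence X) :=
    Finset.sum_congr rfl fun j _ => mul_comm _ _
  rw [e1, e2, e3, e4, e5]
  abel

namespace IsConformal

variable {X : VField 𝕜 U} {φ : Smooth 𝕜 U}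

theorem divergence_eq (h : IsConformal X φ) : divergence X = ((p + q : ℕ) : 𝕜) • φ := by
  have h1 : ∀ i, pd 𝕜 U i (X i) = φ := fun i => by
    have := h.killing i i
    rw [if_pos rfl, ← add_smul, ← two_mul] at this
    refine smul_right_injective _ ?_ this
    exact mul_ne_zero two_ne_zero fun h0 => by simpa [h0] using metric_mul_self (𝕜 := 𝕜) i
  simp [divergence, h1, Nat.cast_smul_eq_nsmul, add_smul]

/-- The argument that determines the Levi-Civita connection: differentiate the Killing equation,
permute the indices cyclically and take an alternating sum, in which all but one second derivative
cancels. -/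
theorem pd_pd_field (h : IsConformal X φ) (i j k : Idx p q) :
    pd 𝕜 U i (pd 𝕜 U j (X k)) = (if j = k then pd 𝕜 U i φ else 0)
      + (if i = k then pd 𝕜 U j φ else 0)
      - if i = j then (metric 𝕜 p q i * metric 𝕜 p q k) • pd 𝕜 U k φ else 0 := by
  have key : ∀ i j k, metric 𝕜 p q k • pd 𝕜 U i (pd 𝕜 U j (X k))
      + metric 𝕜 p q j • pd 𝕜 U i (pd 𝕜 U k (X j))
      = if k = j then (2 * metric 𝕜 p q k) • pd 𝕜 U i φ else 0 := fun i j k => by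
    have := congr_arg (pd 𝕜 U i) (h.killing k j)
    rw [map_add, Derivation.map_smul, Derivation.map_smul] at this
    rw [this]
    split_ifs <;> simp
  have k1 := key i j k
  have k2 := key j i k
  have k3 := key k j i
  rw [pd_comm j i (X k), pd_comm j k (X i)] at k2
  rw [pd_comm k i (X j)] at k3
  have e : (2 : 𝕜) • (metric 𝕜 p q k • pd 𝕜 U i (pd 𝕜 U j (X k)))
      = (if k = j then (2 * metric 𝕜 p q k) • pd 𝕜 U i φ else 0)
        + (if k = i then (2 * metric 𝕜 p q k) • pd 𝕜 U j φ else 0)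
        - (if i = j then (2 * metric 𝕜 p q i) • pd 𝕜 U k φ else 0) := by
    rw [← k1, ← k2, ← k3]
    module
  have e' := congr_arg (fun f => ((2⁻¹ : 𝕜) * metric 𝕜 p q k) • f) e
  have hg := metric_mul_self (𝕜 := 𝕜) k
  have s1 : ((2⁻¹ : 𝕜) * metric 𝕜 p q k) * (2 * metric 𝕜 p q k) = 1 := by
    linear_combination hg
  simp only [smul_add, smul_sub, smul_smul, smul_ite, smul_zero, s1] at e'
  rw [one_smul] at e'
  rw [e']
  simp only [one_smul, @eq_comm _ k, show (2⁻¹ : 𝕜) * metric 𝕜 p q k * (2 * metric 𝕜 p q i)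
    = metric 𝕜 p q i * metric 𝕜 p q k by ring]

theorem sum_pd_pd_field (h : IsConformal X φ) (P : Symb 𝕜 U) (i : Idx p q) :
    ∑ j, ∑ k, c2 P j k * pd 𝕜 U j (pd 𝕜 U k (X i))
      = (2 : 𝕜) • ∑ j, c2 P i j * pd 𝕜 U j φ - metric 𝕜 p q i • (trace P * pd 𝕜 U i φ) := by
  simp only [h.pd_pd_field, mul_add, mul_sub, mul_ite, mul_zero, Finset.sum_add_distrib,
    Finset.sum_sub_distrib, Finset.sum_ite_eq, Finset.sum_ite_eq', Finset.mem_univ, if_true,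
    Finset.sum_ite_irrel, Finset.sum_const_zero, trace, Finset.sum_mul, Finset.smul_sum, two_smul]
  congr 1
  · rw [add_left_inj]
    exact Finset.sum_congr rfl fun j _ => by rw [c2_symm]
  · refine Finset.sum_congr rfl fun j _ => ?_
    rw [mul_smul_comm, smul_mul_assoc, smul_smul, mul_comm (metric 𝕜 p q j)]

/-- The trace is contraction with g, and L_X g = 2φg. -/
theorem trace_lieSymb (h : IsConformal X φ) (δ : 𝕜) (P : Symb 𝕜 U) :
    trace (lieSymb δ X P) = lieDensity δ X (trace P) - (2 : 𝕜) • (φ * trace P) := by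
  have d2 : ∀ i, c2 (lieSymb δ X P) i i = lieDensity δ X (c2 P i i)
      - ∑ k, (pd 𝕜 U k (X i) * c2 P k i + pd 𝕜 U k (X i) * c2 P i k) := fun _ => rfl
  have e : ∑ i, ∑ k, metric 𝕜 p q i • (pd 𝕜 U k (X i) * c2 P k i + pd 𝕜 U k (X i) * c2 P i k)
      = (2 : 𝕜) • (φ * trace P) := by
    have e1 : ∑ i, ∑ k, metric 𝕜 p q i • (pd 𝕜 U k (X i) * c2 P k i)
        = ∑ i, ∑ k, metric 𝕜 p q k • (pd 𝕜 U i (X k) * c2 P i k) := Finset.sum_comm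
    simp only [smul_add, Finset.sum_add_distrib]
    rw [e1]
    simp only [← Finset.sum_add_distrib]
    have e2 : ∀ i k, metric 𝕜 p q k • (pd 𝕜 U i (X k) * c2 P i k)
        + metric 𝕜 p q i • (pd 𝕜 U k (X i) * c2 P i k)
        = if i = k then (2 * metric 𝕜 p q i) • (φ * c2 P i k) else 0 := fun i k => by
      rw [← smul_mul_assoc, ← smul_mul_assoc, ← add_mul, add_comm, h.killing]
      split_ifs <;> simp
    simp only [e2, Finset.sum_ite_eq, Finset.mem_univ, if_true, trace, Finset.mul_sum,
      Finset.smul_sum, mul_smul_comm, smul_smul]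
  simp only [trace, d2, smul_sub, Finset.sum_sub_distrib, Finset.smul_sum] at e ⊢
  rw [e, map_sum]
  simp only [map_smul]

/-- The shift by -2φ is the one that the trace produces; it is absorbed because L_X g⁻¹ = -2φ g⁻¹.
What remains comes from differentiating the factors φ and Div X = nφ. -/
theorem grad_lieDensity (h : IsConformal X φ) (δ : 𝕜) (f : Smooth 𝕜 U) (i : Idx p q) :
    metric 𝕜 p q i • pd 𝕜 U i (lieDensity δ X f - (2 : 𝕜) • (φ * f))
      = lieVec δ X (fun j => metric 𝕜 p q j • pd 𝕜 U j f) i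
        + (((p + q : ℕ) : 𝕜) * δ - 2) • metric 𝕜 p q i • (f * pd 𝕜 U i φ) := by
  have e : ∑ k, metric 𝕜 p q i • (pd 𝕜 U i (X k) * pd 𝕜 U k f)
      + ∑ k, pd 𝕜 U k (X i) * metric 𝕜 p q k • pd 𝕜 U k f
      = (2 * metric 𝕜 p q i) • (φ * pd 𝕜 U i f) := by
    rw [← Finset.sum_add_distrib]
    have e2 : ∀ k, metric 𝕜 p q i • (pd 𝕜 U i (X k) * pd 𝕜 U k f)
        + pd 𝕜 U k (X i) * metric 𝕜 p q k • pd 𝕜 U k f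
        = if i = k then (2 * metric 𝕜 p q i) • (φ * pd 𝕜 U i f) else 0 := fun k => by
      have := congr_arg (fun a => metric 𝕜 p q i • metric 𝕜 p q k • (a * pd 𝕜 U k f))
        (h.killing i k)
      simp only [add_mul, smul_add, smul_mul_assoc, metric_smul_metric_smul] at this
      rw [smul_comm (metric 𝕜 p q k) (metric 𝕜 p q i), metric_smul_metric_smul] at this
      rw [mul_smul_comm, add_comm, this]
      split_ifs with hik
      · subst hik
        rw [metric_smul_metric_smul, smul_mul_assoc]
      · simp
    simp only [e2, Finset.sum_ite_eq, Finset.mem_univ, if_true]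
  rw [lieVec, map_sub, pd_lieDensity, h.divergence_eq]
  simp only [Derivation.map_smul, Derivation.leibniz, smul_eq_mul, smul_add, smul_sub,
    Finset.smul_sum, map_smul]
  rw [eq_sub_of_add_eq e]
  algebra

end IsConformal

/-! ### The generators are conformal Killing fields -/

theorem real_smul_smooth (r : ℝ) (f : Smooth 𝕜 U) : r • f = (r : 𝕜) • f := by
  ext x
  exact RCLike.real_smul_eq_coe_smul (K := 𝕜) r ((f : U → 𝕜) x)

theorem pd_translation (i k l : Idx p q) : pd 𝕜 U l (translation 𝕜 U i k) = 0 := by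
  rw [translation, Pi.single_apply]
  split_ifs <;> simp

theorem pd_rotation (i j k l : Idx p q) : pd 𝕜 U l (rotation 𝕜 U i j k)
    = (if k = j then metric 𝕜 p q i • pd 𝕜 U l (coord i) else 0)
      - if k = i then metric 𝕜 p q j • pd 𝕜 U l (coord j) else 0 := by
  rw [rotation, Pi.sub_apply, map_sub, Pi.single_apply, Pi.single_apply,
    apply_ite (pd 𝕜 U l), apply_ite (pd 𝕜 U l)]
  simp

theorem pd_inversion (i k l : Idx p q) : pd 𝕜 U l (inversion 𝕜 U i k)
    = (if k = i then (2 * metric 𝕜 p q l) • coord l else 0)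
      - (2 * metric 𝕜 p q i) • ((if l = k then coord i else 0) + if l = i then coord k else 0) := by
  have e : pd 𝕜 U l (∑ j, metric 𝕜 p q j • (coord j * coord j))
      = (2 * metric 𝕜 p q l) • coord l := by
    simp only [map_sum, Derivation.map_smul, Derivation.leibniz, pd_coord, smul_eq_mul, mul_ite,
      mul_one, mul_zero, ← two_mul, smul_ite, smul_zero, Finset.sum_ite_eq, Finset.mem_univ,
      if_true]
    algebra
  rw [inversion, Pi.sub_apply, map_sub, Pi.single_apply, apply_ite (pd 𝕜 U l), e, map_zero,
    Derivation.map_smul, Derivation.leibniz, pd_coord, pd_coord]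
  simp

theorem isConformal_translation (i : Idx p q) : IsConformal (translation 𝕜 U i) 0 where
  killing k l := by simp [pd_translation]
  pd_pd := by simp

theorem isConformal_rotation (i j : Idx p q) : IsConformal (rotation 𝕜 U i j) 0 where
  killing k l := by
    rw [pd_rotation, pd_rotation]
    simp only [pd_coord, smul_sub, smul_ite, smul_zero, ite_self]
    have e : (if k = j then if l = i then metric 𝕜 p q k • metric 𝕜 p q i • (1 : Smooth 𝕜 U) else 0
        else 0) = (if l = i then if k = j then metric 𝕜 p q l • metric 𝕜 p q j • (1 : Smooth 𝕜 U)
        else 0 else 0) := by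
      split_ifs with h1 h2 <;> first | rfl | (subst h1 h2; rw [smul_comm])
    have e' : (if k = i then if l = j then metric 𝕜 p q k • metric 𝕜 p q j • (1 : Smooth 𝕜 U) else 0
        else 0) = (if l = j then if k = i then metric 𝕜 p q l • metric 𝕜 p q i • (1 : Smooth 𝕜 U)
        else 0 else 0) := by
      split_ifs with h1 h2 <;> first | rfl | (subst h1 h2; rw [smul_comm])
    rw [e, e']
    abel
  pd_pd := by simp

theorem isConformal_homothety : IsConformal (homothety 𝕜 U) 1 where
  killing k l := by
    simp only [homothety, pd_coord]
    by_cases h : k = l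
    · subst h; simp only [if_true]; module
    · simp [h, Ne.symm h]
  pd_pd := by simp

theorem isConformal_inversion (i : Idx p q) :
    IsConformal (inversion 𝕜 U i) ((-2 * metric 𝕜 p q i) • coord i) where
  killing k l := by
    rw [pd_inversion, pd_inversion]
    by_cases h : k = l
    · subst h
      by_cases hi : k = i
      · subst hi; simp only [if_true]; module
      · simp only [if_true, hi, if_false]; module
    · by_cases hi : k = i
      · subst hi; simp only [if_true, h, Ne.symm h, if_false]; module
      · by_cases hl : l = i
        · subst hl; simp only [if_true, hi, Ne.symm h, if_false]; module
        · simp [hi, hl, h, Ne.symm h]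
  pd_pd k l := by simp [pd_pd_coord]

/-- The conditions are linear in the pair (X, φ), so the generators suffice: φ is 0, 0, 1 and -2xᵢ
respectively. -/
theorem exists_isConformal {X : VField 𝕜 U} (hX : X ∈ confAlg 𝕜 U) : ∃ φ, IsConformal X φ := by
  induction hX using Submodule.span_induction with
  | mem X h =>
    rcases h with ((⟨i, rfl⟩ | ⟨ij, rfl⟩) | h) | ⟨i, rfl⟩
    · exact ⟨_, isConformal_translation i⟩
    · exact ⟨_, isConformal_rotation ij.1 ij.2⟩
    · rw [Set.mem_singleton_iff.1 h]; exact ⟨_, isConformal_homothety⟩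
    · exact ⟨_, isConformal_inversion i⟩
  | zero => exact ⟨0, by simp, by simp⟩
  | add X Y _ _ hX hY =>
    obtain ⟨φ, hφ⟩ := hX
    obtain ⟨ψ, hψ⟩ := hY
    refine ⟨φ + ψ, fun i j => ?_, fun i j => by simp [hφ.pd_pd, hψ.pd_pd]⟩
    have h1 := hφ.killing i j
    have h2 := hψ.killing i j
    simp only [Pi.add_apply, map_add, smul_add]
    rw [add_add_add_comm, h1, h2]
    split_ifs <;> simp
  | smul r X _ hX =>
    obtain ⟨φ, hφ⟩ := hX
    refine ⟨(r : 𝕜) • φ, fun i j => ?_, fun i j => by simp [hφ.pd_pd]⟩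
    have h1 := congr_arg (fun a => (r : 𝕜) • a) (hφ.killing i j)
    simp only [Pi.smul_apply, real_smul_smooth, Derivation.map_smul]
    rw [smul_comm _ (r : 𝕜), smul_comm _ (r : 𝕜), ← smul_add, h1]
    split_ifs
    · rw [smul_comm]
    · simp

/-! ### The ansatz for the total symbol of the quantization map -/

/-- The gradient `g^{ij} ∂ⱼ f`. -/
def grad (f : Smooth 𝕜 U) : VField 𝕜 U := fun i => metric 𝕜 p q i • pd 𝕜 U i f

theorem divergence_add (V W : VField 𝕜 U) : divergence (V + W) = divergence V + divergence W := by
  simp [divergence, Finset.sum_add_distrib]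

theorem divergence_smul (c : 𝕜) (W : VField 𝕜 U) : divergence (c • W) = c • divergence W := by
  simp [divergence, Finset.smul_sum]

theorem lieVec_add (δ : 𝕜) (X V W : VField 𝕜 U) :
    lieVec δ X (V + W) = lieVec δ X V + lieVec δ X W := by
  funext i
  simp only [lieVec, Pi.add_apply, map_add, mul_add, Finset.sum_add_distrib]
  abel

theorem lieVec_smul (δ c : 𝕜) (X W : VField 𝕜 U) :
    lieVec δ X (c • W) = c • lieVec δ X W := by
  funext i
  simp only [lieVec, Pi.smul_apply, map_smul, mul_smul_comm, smul_sub, Finset.smul_sum]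

/-- The part of the quantization map that lowers the degree, as a map of total symbols. -/
def quantLower (α β₁ β₂ β₃ β₄ : 𝕜) : Module.End 𝕜 (Symb 𝕜 U) where
  toFun P := ⟨(0, β₁ • div2 P + β₂ • grad (trace P),
    α • divergence (c1 P) + β₃ • divergence (div2 P) + β₄ • divergence (grad (trace P))),
    fun _ _ => rfl⟩
  map_add' P R := by
    have h2 : div2 (P + R) = div2 P + div2 R := by
      funext i
      simp only [div2, Pi.add_apply, ← Finset.sum_add_distrib, ← map_add]; rfl
    have h1 : c1 (P + R) = c1 P + c1 R := rfl
    have h3 : grad (trace (P + R)) = grad (trace P) + grad (trace R) := by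
      have : trace (P + R) = trace P + trace R := by
        simp only [trace, ← Finset.sum_add_distrib, ← smul_add]; rfl
      funext i
      simp [grad, this]
    refine Subtype.ext (Prod.ext ?_ (Prod.ext ?_ ?_))
    · exact (add_zero 0).symm
    · simp only [h2, h3, smul_add, Submodule.coe_add, Prod.snd_add, Prod.fst_add]; abel
    · simp only [h1, h2, h3, divergence_add, smul_add, Submodule.coe_add, Prod.snd_add]; abel
  map_smul' c P := by
    have h2 : div2 (c • P) = c • div2 P := by
      funext i
      simp only [div2, Pi.smul_apply, Finset.smul_sum, ← Derivation.map_smul]; rfl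
    have h1 : c1 (c • P) = c • c1 P := rfl
    have h3 : grad (trace (c • P)) = c • grad (trace P) := by
      have : trace (c • P) = c • trace P := by
        simp only [trace, Finset.smul_sum]
        refine Finset.sum_congr rfl fun i _ => ?_
        rw [smul_comm c]; rfl
      funext i
      simp [grad, this, smul_comm c]
    refine Subtype.ext (Prod.ext ?_ (Prod.ext ?_ ?_))
    · exact (smul_zero c).symm
    · simp only [h2, h3, smul_add, Submodule.coe_smul, Prod.smul_snd, Prod.smul_fst,
        RingHom.id_apply, smul_comm c]
    · simp only [h1, h2, h3, divergence_smul, smul_add, Submodule.coe_smul, Prod.smul_snd,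
        RingHom.id_apply, smul_comm c]

theorem c1_quantLower (α β₁ β₂ β₃ β₄ : 𝕜) (P : Symb 𝕜 U) :
    c1 (quantLower α β₁ β₂ β₃ β₄ P) = β₁ • div2 P + β₂ • grad (trace P) := rfl

theorem c0_quantLower (α β₁ β₂ β₃ β₄ : 𝕜) (P : Symb 𝕜 U) :
    c0 (quantLower α β₁ β₂ β₃ β₄ P) = α • divergence (c1 P) + β₃ • divergence (div2 P)
      + β₄ • divergence (grad (trace P)) := rfl

theorem trace_eq_zero {P : Symb 𝕜 U} (h : c2 P = 0) : trace P = 0 := by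
  simp [trace, h]

theorem div2_eq_zero {P : Symb 𝕜 U} (h : c2 P = 0) : div2 P = 0 := by
  funext i
  simp [div2, h]

theorem grad_zero : grad (0 : Smooth 𝕜 U) = 0 := by
  funext i
  simp [grad]

theorem divergence_zero : divergence (0 : VField 𝕜 U) = 0 := by
  simp [divergence]

theorem c1_quantLower_eq_zero (α β₁ β₂ β₃ β₄ : 𝕜) {P : Symb 𝕜 U} (h : c2 P = 0) :
    c1 (quantLower α β₁ β₂ β₃ β₄ P) = 0 := by
  rw [c1_quantLower, trace_eq_zero h, div2_eq_zero h, grad_zero, smul_zero, smul_zero, add_zero]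

theorem c0_quantLower_eq_zero (α β₁ β₂ β₃ β₄ : 𝕜) {P : Symb 𝕜 U} (h : c2 P = 0) (h' : c1 P = 0) :
    c0 (quantLower α β₁ β₂ β₃ β₄ P) = 0 := by
  rw [c0_quantLower, h', trace_eq_zero h, div2_eq_zero h, grad_zero, divergence_zero, smul_zero,
    smul_zero, smul_zero, add_zero, add_zero]

theorem quantLower_quantLower_quantLower (α β₁ β₂ β₃ β₄ : 𝕜) (P : Symb 𝕜 U) :
    quantLower α β₁ β₂ β₃ β₄ (quantLower α β₁ β₂ β₃ β₄ (quantLower α β₁ β₂ β₃ β₄ P)) = 0 := by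
  have h2 : ∀ R : Symb 𝕜 U, c2 (quantLower α β₁ β₂ β₃ β₄ R) = 0 := fun R => rfl
  have h1 : ∀ R : Symb 𝕜 U,
      c1 (quantLower α β₁ β₂ β₃ β₄ (quantLower α β₁ β₂ β₃ β₄ R)) = 0 := fun R =>
    c1_quantLower_eq_zero _ _ _ _ _ (h2 R)
  exact symb_ext (fun i j => rfl) (fun i => congr_fun (h1 _) i)
    (c0_quantLower_eq_zero _ _ _ _ _ (h2 _) (h1 _))

/-- The automorphism `1 + N` of a module, for `N` with `N ^ 3 = 0`. -/
def oneAddEquiv {V : Type*} [AddCommMonoid V] [Module 𝕜 V] (N : V →ₗ[𝕜] V)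
    (h : ∀ v, N (N (N v)) = 0) : V ≃ₗ[𝕜] V :=
  { LinearMap.id + N with
    invFun := fun v => v + (-1 : 𝕜) • N v + N (N v)
    left_inv := fun v => by
      simp only [AddHom.toFun_eq_coe, LinearMap.coe_toAddHom, LinearMap.add_apply,
        LinearMap.id_apply, map_add, h]
      module
    right_inv := fun v => by
      simp only [AddHom.toFun_eq_coe, LinearMap.coe_toAddHom, LinearMap.add_apply,
        LinearMap.id_apply, map_add, map_smul, h]
      module }

/-- The total symbol of the quantization map. -/
def quantEquiv (α β₁ β₂ β₃ β₄ : 𝕜) : Symb 𝕜 U ≃ₗ[𝕜] Symb 𝕜 U :=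
  oneAddEquiv (quantLower α β₁ β₂ β₃ β₄) (quantLower_quantLower_quantLower α β₁ β₂ β₃ β₄)

theorem quantEquiv_apply (α β₁ β₂ β₃ β₄ : 𝕜) (P : Symb 𝕜 U) :
    quantEquiv (U := U) α β₁ β₂ β₃ β₄ P = P + quantLower α β₁ β₂ β₃ β₄ P := rfl

/-! ### The equations for the coefficients -/

section Equivariance

variable {X : VField 𝕜 U} {φ : Smooth 𝕜 U}

theorem IsConformal.div2_lieSymb_eq (h : IsConformal X φ) (δ : 𝕜) (P : Symb 𝕜 U) :
    div2 (lieSymb δ X P) = lieVec δ X (div2 P)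
      + ((p + q : ℕ) * (δ - 1) - 2 : 𝕜) • (fun i => ∑ j, c2 P i j * pd 𝕜 U j φ : VField 𝕜 U)
      + (fun i => metric 𝕜 p q i • (trace P * pd 𝕜 U i φ) : VField 𝕜 U) := by
  funext i
  rw [div2_lieSymb, h.sum_pd_pd_field, h.divergence_eq]
  simp only [Derivation.map_smul, mul_smul_comm, ← Finset.smul_sum, Pi.add_apply, Pi.smul_apply]
  module

theorem IsConformal.grad_trace_lieSymb (h : IsConformal X φ) (δ : 𝕜) (P : Symb 𝕜 U) :
    grad (trace (lieSymb δ X P)) = lieVec δ X (grad (trace P))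
      + ((p + q : ℕ) * δ - 2 : 𝕜) •
        (fun i => metric 𝕜 p q i • (trace P * pd 𝕜 U i φ) : VField 𝕜 U) := by
  funext i
  rw [h.trace_lieSymb, grad, h.grad_lieDensity]
  rfl

/-- Here, and in the next lemma, ∂∂φ = 0 keeps φ from entering with more than one derivative. -/
theorem IsConformal.divergence_contract (h : IsConformal X φ) (P : Symb 𝕜 U) :
    divergence (fun i => ∑ j, c2 P i j * pd 𝕜 U j φ : VField 𝕜 U)
      = ∑ i, pd 𝕜 U i φ * div2 P i := by
  simp only [divergence, map_sum, Derivation.leibniz, h.pd_pd, mul_zero, zero_add, smul_eq_mul,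
    div2, Finset.mul_sum]
  rw [Finset.sum_comm]
  exact Finset.sum_congr rfl fun i _ => Finset.sum_congr rfl fun j _ => by rw [c2_symm]

theorem IsConformal.divergence_mul_grad (h : IsConformal X φ) (f : Smooth 𝕜 U) :
    divergence (fun i => metric 𝕜 p q i • (f * pd 𝕜 U i φ) : VField 𝕜 U)
      = ∑ i, pd 𝕜 U i φ * grad f i := by
  simp only [divergence, Derivation.map_smul, Derivation.leibniz, h.pd_pd, mul_zero, zero_add,
    smul_eq_mul, grad, mul_smul_comm]

theorem IsConformal.divergence_lieVec_eq (h : IsConformal X φ) (δ : 𝕜) (W : VField 𝕜 U) :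
    divergence (lieVec δ X W) = lieDensity δ X (divergence W)
      + ((p + q : ℕ) * (δ - 1) : 𝕜) • ∑ i, pd 𝕜 U i φ * W i := by
  rw [divergence_lieVec, h.divergence_eq]
  simp only [Derivation.map_smul, smul_mul_assoc, ← Finset.smul_sum]
  module

theorem IsConformal.c1_opDefect (h : IsConformal X φ) (lam : 𝕜) (A : Symb 𝕜 U) :
    c1 (opDefect lam X A)
      = (2 * (1 + (p + q : ℕ) * lam) : 𝕜) • (fun i => ∑ j, c2 A i j * pd 𝕜 U j φ : VField 𝕜 U)
        - (fun i => metric 𝕜 p q i • (trace A * pd 𝕜 U i φ) : VField 𝕜 U) := by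
  funext i
  change ∑ j, ∑ k, c2 A j k * pd 𝕜 U j (pd 𝕜 U k (X i))
      + (2 * lam) • ∑ j, c2 A i j * pd 𝕜 U j (divergence X) = _
  rw [h.sum_pd_pd_field, h.divergence_eq]
  simp only [Derivation.map_smul, mul_smul_comm, ← Finset.smul_sum, Pi.sub_apply, Pi.smul_apply]
  module

theorem IsConformal.c0_opDefect (h : IsConformal X φ) (lam : 𝕜) (A : Symb 𝕜 U) :
    c0 (opDefect lam X A) = (lam * (p + q : ℕ) : 𝕜) • ∑ i, pd 𝕜 U i φ * c1 A i := by
  change lam • ∑ i, ∑ j, c2 A i j * pd 𝕜 U i (pd 𝕜 U j (divergence X))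
      + lam • ∑ i, c1 A i * pd 𝕜 U i (divergence X) = _
  rw [h.divergence_eq]
  simp only [Derivation.map_smul, h.pd_pd, smul_zero, mul_zero, Finset.sum_const_zero, zero_add,
    mul_smul, mul_comm (c1 A _), smul_mul_assoc, ← Finset.smul_sum]

-- Each hypothesis balances one contraction with ∂φ: `h₁` that of P₂, `h₂` the trace of P₂ times
-- grad φ, both in degree 1; in degree 0, `hα` that of P₁, `h₃` that of div P₂, and `h₄` that of
-- grad tr P₂.
set_option maxHeartbeats 1000000 in
theorem IsConformal.quantEquiv_lieSymb (h : IsConformal X φ) {lam δ α β₁ β₂ β₃ β₄ : 𝕜}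
    (hα : α * (1 - δ) = lam)
    (h₁ : β₁ * (2 + (p + q : ℕ) * (1 - δ)) = 2 * (1 + (p + q : ℕ) * lam))
    (h₂ : β₁ + β₂ * ((p + q : ℕ) * δ - 2) = 1)
    (h₃ : β₃ * (2 + 2 * (p + q : ℕ) * (1 - δ)) = lam * (p + q : ℕ) * β₁)
    (h₄ : β₃ + β₄ * ((p + q : ℕ) * (2 * δ - 1) - 2) = - (lam * (p + q : ℕ) * β₂))
    (P : Symb 𝕜 U) :
    quantEquiv (U := U) α β₁ β₂ β₃ β₄ (lieSymb δ X P) = lieSymb δ X (quantEquiv (U := U) α β₁ β₂ β₃ β₄ P)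
      - opDefect lam X (quantEquiv (U := U) α β₁ β₂ β₃ β₄ P) := by
  set A := quantEquiv (U := U) α β₁ β₂ β₃ β₄ P with hA
  have a2 : c2 A = c2 P := add_zero _
  have a1 : c1 A = c1 P + (β₁ • div2 P + β₂ • grad (trace P)) := rfl
  have a0 : c0 A = c0 P + (α • divergence (c1 P) + β₃ • divergence (div2 P)
      + β₄ • divergence (grad (trace P))) := rfl
  have atr : trace A = trace P := by rw [trace, trace, a2]
  have l1 : ∀ R : Symb 𝕜 U, c1 (lieSymb δ X R) = lieVec δ X (c1 R) := fun _ => rfl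
  have l0 : ∀ R : Symb 𝕜 U, c0 (lieSymb δ X R) = lieDensity δ X (c0 R) := fun _ => rfl
  rw [quantEquiv_apply]
  have e1 : c1 (lieSymb δ X P + quantLower α β₁ β₂ β₃ β₄ (lieSymb δ X P))
      = c1 (lieSymb δ X A - opDefect lam X A) := by
    change c1 (lieSymb δ X P) + c1 (quantLower α β₁ β₂ β₃ β₄ (lieSymb δ X P))
      = c1 (lieSymb δ X A) - c1 (opDefect lam X A)
    rw [c1_quantLower, h.c1_opDefect, l1, l1, a1, h.div2_lieSymb_eq, h.grad_trace_lieSymb, atr, a2,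
      lieVec_add, lieVec_add, lieVec_smul, lieVec_smul]
    -- All other terms are Lie derivatives of the same fields on both sides, so the identity is
    -- linear in a few abstract vectors.
    set V : VField 𝕜 U := fun i => ∑ j, c2 P i j * pd 𝕜 U j φ
    set T : VField 𝕜 U := fun i => metric 𝕜 p q i • (trace P * pd 𝕜 U i φ)
    funext i
    simp only [Pi.add_apply, Pi.sub_apply, Pi.smul_apply]
    generalize V i = v, T i = t, lieVec δ X (c1 P) i = w, lieVec δ X (div2 P) i = d,
      lieVec δ X (grad (trace P)) i = e
    linear_combination (norm := module) (-h₁) • v + h₂ • t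
  refine symb_ext (fun i j => ?_) (fun i => congr_fun e1 i) ?_
  · change c2 (lieSymb δ X P) i j + 0 = c2 (lieSymb δ X A) i j - 0
    rw [add_zero, sub_zero]
    change lieDensity δ X (c2 P i j) - _ = lieDensity δ X (c2 A i j) - _
    rw [a2]
  · change c0 (lieSymb δ X P) + c0 (quantLower α β₁ β₂ β₃ β₄ (lieSymb δ X P))
      = c0 (lieSymb δ X A) - c0 (opDefect lam X A)
    rw [c0_quantLower, h.c0_opDefect, l0, l0, l1, a1, a0, h.div2_lieSymb_eq, h.grad_trace_lieSymb]
    simp only [divergence_add, divergence_smul, h.divergence_lieVec_eq, h.divergence_contract,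
      h.divergence_mul_grad, map_add, map_smul, Pi.add_apply, Pi.smul_apply, mul_add,
      mul_smul_comm, Finset.sum_add_distrib, ← Finset.smul_sum]
    generalize ∑ i, pd 𝕜 U i φ * c1 P i = V, ∑ i, pd 𝕜 U i φ * div2 P i = D,
      ∑ i, pd 𝕜 U i φ * grad (trace P) i = T, lieDensity δ X (c0 P) = a,
      lieDensity δ X (divergence (c1 P)) = b, lieDensity δ X (divergence (div2 P)) = c,
      lieDensity δ X (divergence (grad (trace P))) = d
    linear_combination (norm := module) (-((p + q : ℕ) : 𝕜) * hα) • V - h₃ • D + h₄ • T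

end Equivariance

/-! ### The Casimir element as a formula in operators -/

section Casimir

variable {V V' : Type*}

/-- The Casimir element of `o(p+1,q+1)`, for operators `T`, `R`, `E`, `B` by which the translations,
rotations, the homothety and the inversions act. -/
def casimir (p q : ℕ) [AddCommMonoid V] [Module 𝕜 V] (T : Idx p q → V → V)
    (R : Idx p q → Idx p q → V → V) (E : V → V) (B : Idx p q → V → V) (v : V) : V :=
  ∑ i, metric 𝕜 p q i • B i (T i v)
    + (-1 / 2 : 𝕜) • ∑ i, ∑ j, (metric 𝕜 p q i * metric 𝕜 p q j) • R i j (R i j v)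
    + E (E v) + (-(p + q : ℕ) : 𝕜) • E v

/-- Only linearity of the intertwiner is used: the generators may act by arbitrary functions. -/
theorem map_casimir [AddCommMonoid V] [Module 𝕜 V] [AddCommMonoid V'] [Module 𝕜 V']
    {T : Idx p q → V → V} {R : Idx p q → Idx p q → V → V} {E : V → V} {B : Idx p q → V → V}
    {T' : Idx p q → V' → V'} {R' : Idx p q → Idx p q → V' → V'} {E' : V' → V'}
    {B' : Idx p q → V' → V'} (π : V →ₗ[𝕜] V') (hT : ∀ i v, π (T i v) = T' i (π v))
    (hR : ∀ i j v, π (R i j v) = R' i j (π v)) (hE : ∀ v, π (E v) = E' (π v))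
    (hB : ∀ i v, π (B i v) = B' i (π v)) (v : V) :
    π (casimir (𝕜 := 𝕜) p q T R E B v) = casimir (𝕜 := 𝕜) p q T' R' E' B' (π v) := by
  simp only [casimir, map_add, map_sum, map_smul, hT, hR, hE, hB]

/-- The Casimir element in a representation on tensor fields: only the spin part survives. -/
theorem casimir_eq [AddCommGroup V] [Module 𝕜 V] (x d : Idx p q → V →ₗ[𝕜] V)
    (S : Idx p q → Idx p q → V →ₗ[𝕜] V) (c : 𝕜)
    (hxx : ∀ i j v, x i (x j v) = x j (x i v)) (hdd : ∀ i j v, d i (d j v) = d j (d i v))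
    (hdx : ∀ i j v, d i (x j v) = x j (d i v) + if i = j then v else 0)
    (hSx : ∀ i j k v, S i j (x k v) = x k (S i j v))
    (hSd : ∀ i j k v, d k (S i j v) = S i j (d k v)) (hS : ∀ i j v, S i j v = - S j i v)
    (v : V) :
    casimir (𝕜 := 𝕜) p q (fun i => d i)
      (fun i j v => metric 𝕜 p q i • x i (d j v) - metric 𝕜 p q j • x j (d i v) + S i j v)
      (fun v => ∑ k, x k (d k v) + c • v)
      (fun i v => ∑ j, metric 𝕜 p q j • x j (x j (d i v))
        - (2 * metric 𝕜 p q i) • x i (∑ k, x k (d k v) + c • v) - (2 : 𝕜) • ∑ j, x j (S i j v)) v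
    = (c ^ 2 - (p + q : ℕ) * c) • v
      - (1 / 2 : 𝕜) • ∑ i, ∑ j, (metric 𝕜 p q i * metric 𝕜 p q j) • S i j (S i j v) := by
  set g := metric 𝕜 p q with hg
  have gg : ∀ i, g i * g i = 1 := metric_mul_self
  set e := ∑ k, x k (d k v) with he
  set F := ∑ i, ∑ j, x i (x j (d i (d j v))) with hF
  set X := ∑ i, ∑ j, (g i * g j) • x i (x i (d j (d j v))) with hX
  set Y := ∑ i, g i • ∑ j, x j (S i j (d i v)) with hY
  set Z := ∑ i, ∑ j, (g i * g j) • S i j (S i j v) with hZ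
  have hYZ : ∑ i, ∑ j, g j • x i (S i j (d j v)) = - Y := by
    rw [hY, Finset.sum_comm]
    simp only [← Finset.sum_neg_distrib, Finset.smul_sum]
    refine Finset.sum_congr rfl fun i _ => Finset.sum_congr rfl fun j _ => ?_
    rw [hS, map_neg, smul_neg]
  have h1 : ∑ i, g i • (∑ j, g j • x j (x j (d i (d i v)))
        - (2 * g i) • x i (∑ k, x k (d k (d i v)) + c • d i v)
        - (2 : 𝕜) • ∑ j, x j (S i j (d i v)))
      = X - (2 : 𝕜) • F - (2 * c) • e - (2 : 𝕜) • Y := by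
    have : ∀ i, g i • (∑ j, g j • x j (x j (d i (d i v)))
        - (2 * g i) • x i (∑ k, x k (d k (d i v)) + c • d i v)
        - (2 : 𝕜) • ∑ j, x j (S i j (d i v)))
        = ∑ j, (g j * g i) • x j (x j (d i (d i v))) - (2 : 𝕜) • ∑ k, x i (x k (d i (d k v)))
          - (2 * c) • x i (d i v) - (2 : 𝕜) • ∑ j, g i • x j (S i j (d i v)) := fun i => by
      simp only [map_add, map_sum, map_smul, smul_sub, smul_add, Finset.smul_sum, smul_smul,
        hdd _ i]
      rw [show g i * (2 * g i) = 2 by linear_combination 2 * gg i,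
        show g i * (2 * g i * c) = 2 * c by linear_combination 2 * c * gg i, mul_comm (g i) 2]
      simp only [mul_comm (g i)]
      abel
    rw [Finset.sum_congr rfl fun i _ => this i]
    simp only [Finset.sum_sub_distrib, ← Finset.smul_sum]
    rw [Finset.sum_comm, ← hX, ← hF, ← he, ← hY]
  have h2 : ∑ i, ∑ j, (g i * g j) • (g i • x i (d j (g i • x i (d j v) - g j • x j (d i v)
          + S i j v)) - g j • x j (d i (g i • x i (d j v) - g j • x j (d i v) + S i j v))
          + S i j (g i • x i (d j v) - g j • x j (d i v) + S i j v))
      = (2 : 𝕜) • X + (2 : 𝕜) • e - (2 : 𝕜) • F - (2 * (p + q : ℕ) : 𝕜) • e - (4 : 𝕜) • Y + Z := by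
    have : ∀ i j, (g i * g j) • (g i • x i (d j (g i • x i (d j v) - g j • x j (d i v)
          + S i j v)) - g j • x j (d i (g i • x i (d j v) - g j • x j (d i v) + S i j v))
          + S i j (g i • x i (d j v) - g j • x j (d i v) + S i j v))
        = ((g i * g j) • x i (x i (d j (d j v))) + (g j * g i) • x j (x j (d i (d i v))))
          + (2 : 𝕜) • (if i = j then x i (d j v) else 0)
          - (x i (x j (d i (d j v))) + x j (x i (d j (d i v))))
          - (x i (d i v) + x j (d j v))
          + (2 : 𝕜) • (g j • x i (S i j (d j v))) - (2 : 𝕜) • (g i • x j (S i j (d i v)))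
          + (g i * g j) • S i j (S i j v) := fun i j => by
      simp only [map_add, map_sub, map_smul, hdx, hSd, hSx, if_true, hdd j i]
      by_cases hij : i = j
      · subst hij
        simp only [if_true, gg]
        have := gg i
        have g3 : g i ^ 2 = 1 := by rw [pow_two, this]
        simp only [smul_add, smul_sub, smul_smul, gg, mul_one]
        module
      · simp only [hij, Ne.symm hij, if_false, map_zero, smul_zero, add_zero]
        have a1 : g i * g j * (g i * g i) = g i * g j := by rw [gg, mul_one]
        have a2 : g i * g j * (g j * g j) = g i * g j := by rw [gg, mul_one]
        have a3 : g i * g j * (g i * g j) = 1 := by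
          linear_combination g j * g j * gg i + gg j
        have a4 : g i * g j * (g j * g i) = 1 := by
          linear_combination g j * g j * gg i + gg j
        have a5 : g i * g j * g i = g j := by linear_combination g j * gg i
        have a6 : g i * g j * g j = g i := by linear_combination g i * gg j
        simp only [smul_add, smul_sub, smul_smul, a1, a2, a3, a4, a5, a6, one_smul, hxx j i]
        module
    simp only [this, Finset.sum_add_distrib, Finset.sum_sub_distrib, ← Finset.smul_sum,
      Finset.sum_ite_eq, Finset.mem_univ, if_true, Finset.sum_const, Finset.card_univ]
    rw [hYZ, Finset.sum_comm (f := fun i j => (g j * g i) • x j (x j (d i (d i v)))),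
      Finset.sum_comm (f := fun i j => x j (x i (d j (d i v))))]
    rw [← hX, ← hF, ← hY, ← hZ, ← he, Fintype.card_sum, Fintype.card_fin, Fintype.card_fin,
      ← Nat.cast_smul_eq_nsmul 𝕜]
    module
  have h3 : ∑ k, x k (d k (e + c • v)) = F + e + c • e := by
    simp only [he, map_add, map_sum, map_smul, hdx, Finset.sum_add_distrib, ← Finset.smul_sum]
    simp only [apply_ite, map_zero, Finset.sum_ite_eq, Finset.mem_univ, if_true]
    rw [hF]
  rw [casimir]
  simp only [← hg]
  rw [h1, h2, h3]
  module

/-- Transports the computation to the homogeneous component `π` of a representation. -/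
theorem map_casimir_eq [AddCommMonoid V'] [Module 𝕜 V'] [AddCommGroup V] [Module 𝕜 V]
    (π : V' →ₗ[𝕜] V) (x d : Idx p q → V →ₗ[𝕜] V) (S : Idx p q → Idx p q → V →ₗ[𝕜] V) (c : 𝕜)
    (hxx : ∀ i j v, x i (x j v) = x j (x i v)) (hdd : ∀ i j v, d i (d j v) = d j (d i v))
    (hdx : ∀ i j v, d i (x j v) = x j (d i v) + if i = j then v else 0)
    (hSx : ∀ i j k v, S i j (x k v) = x k (S i j v))
    (hSd : ∀ i j k v, d k (S i j v) = S i j (d k v)) (hS : ∀ i j v, S i j v = - S j i v)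
    {T : Idx p q → V' → V'} {R : Idx p q → Idx p q → V' → V'} {E : V' → V'}
    {B : Idx p q → V' → V'} (hT : ∀ i v, π (T i v) = d i (π v))
    (hR : ∀ i j v, π (R i j v) = metric 𝕜 p q i • x i (d j (π v))
      - metric 𝕜 p q j • x j (d i (π v)) + S i j (π v))
    (hE : ∀ v, π (E v) = ∑ k, x k (d k (π v)) + c • π v)
    (hB : ∀ i v, π (B i v) = ∑ j, metric 𝕜 p q j • x j (x j (d i (π v)))
      - (2 * metric 𝕜 p q i) • x i (∑ k, x k (d k (π v)) + c • π v)
      - (2 : 𝕜) • ∑ j, x j (S i j (π v))) (v : V') :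
    π (casimir (𝕜 := 𝕜) p q T R E B v) = (c ^ 2 - (p + q : ℕ) * c) • π v
      - (1 / 2 : 𝕜) • ∑ i, ∑ j, (metric 𝕜 p q i * metric 𝕜 p q j) • S i j (S i j (π v)) :=
  (map_casimir π hT hR hE hB v).trans (casimir_eq x d S c hxx hdd hdx hSx hSd hS (π v))

end Casimir

/-! ### Explicit action of the generators, and the spin operators -/

theorem lieDensity_translation (δ : 𝕜) (i : Idx p q) (f : Smooth 𝕜 U) :
    lieDensity δ (translation 𝕜 U i) f = pd 𝕜 U i f := by
  rw [lieDensity_apply, (isConformal_translation i).divergence_eq]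
  simp only [translation, Pi.single_apply, ite_mul, one_mul, zero_mul, Finset.sum_ite_eq',
    Finset.mem_univ, if_true, smul_zero, add_zero]

theorem lieDensity_rotation (δ : 𝕜) (i j : Idx p q) (f : Smooth 𝕜 U) :
    lieDensity δ (rotation 𝕜 U i j) f
      = metric 𝕜 p q i • (coord i * pd 𝕜 U j f) - metric 𝕜 p q j • (coord j * pd 𝕜 U i f) := by
  rw [lieDensity_apply, (isConformal_rotation i j).divergence_eq]
  simp only [rotation, Pi.sub_apply, Pi.single_apply, sub_mul, ite_mul, zero_mul,
    Finset.sum_sub_distrib, Finset.sum_ite_eq', Finset.mem_univ, if_true, smul_zero, add_zero,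
    smul_mul_assoc]

theorem lieDensity_homothety (δ : 𝕜) (f : Smooth 𝕜 U) :
    lieDensity δ (homothety 𝕜 U) f
      = ∑ k, coord k * pd 𝕜 U k f + ((p + q : ℕ) * δ : 𝕜) • f := by
  rw [lieDensity_apply, isConformal_homothety.divergence_eq]
  rw [smul_mul_assoc, one_mul, smul_smul, mul_comm δ]
  rfl

theorem lieDensity_inversion (δ : 𝕜) (i : Idx p q) (f : Smooth 𝕜 U) :
    lieDensity δ (inversion 𝕜 U i) f
      = ∑ j, metric 𝕜 p q j • (coord j * (coord j * pd 𝕜 U i f))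
        - (2 * metric 𝕜 p q i) • (coord i * (∑ k, coord k * pd 𝕜 U k f
          + ((p + q : ℕ) * δ : 𝕜) • f)) := by
  rw [lieDensity_apply, (isConformal_inversion i).divergence_eq]
  simp only [inversion, Pi.sub_apply, Pi.single_apply, sub_mul, ite_mul, zero_mul,
    Finset.sum_sub_distrib, Finset.sum_ite_eq', Finset.mem_univ, if_true, smul_mul_assoc,
    Finset.sum_mul, mul_assoc, mul_add, Finset.mul_sum, smul_add, Finset.smul_sum, mul_smul_comm]
  module

/-- The infinitesimal rotation in the `(i, j)`-plane of the values of vector fields. -/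
def spin (i j : Idx p q) : VField 𝕜 U →ₗ[𝕜] VField 𝕜 U where
  toFun W l := (if l = i then metric 𝕜 p q j • W j else 0) - if l = j then metric 𝕜 p q i • W i else 0
  map_add' V W := by
    funext l
    simp only [Pi.add_apply, smul_add]
    split_ifs <;> abel
  map_smul' c W := by
    funext l
    simp only [Pi.smul_apply, RingHom.id_apply]
    split_ifs <;> module

theorem spin_apply (i j l : Idx p q) (W : VField 𝕜 U) : spin i j W l
    = (if l = i then metric 𝕜 p q j • W j else 0) - if l = j then metric 𝕜 p q i • W i else 0 := rfl

theorem spin_swap (i j l : Idx p q) (W : VField 𝕜 U) : spin i j W l = - spin j i W l := by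
  rw [spin_apply, spin_apply, neg_sub]

theorem slot_rotation (i j l : Idx p q) (W : VField 𝕜 U) :
    ∑ k, pd 𝕜 U k (rotation 𝕜 U i j l) * W k = - spin i j W l := by
  simp only [pd_rotation, pd_coord, smul_ite, smul_zero, sub_mul, ite_mul, zero_mul,
    Finset.sum_sub_distrib, Finset.sum_ite_irrel, Finset.sum_const_zero, Finset.sum_ite_eq',
    Finset.mem_univ, if_true, spin_apply, neg_sub, smul_mul_assoc, one_mul]

theorem slot_homothety (l : Idx p q) (W : VField 𝕜 U) :
    ∑ k, pd 𝕜 U k (homothety 𝕜 U l) * W k = W l := by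
  simp only [homothety, pd_coord, ite_mul, one_mul, zero_mul, Finset.sum_ite_eq', Finset.mem_univ,
    if_true]

/-- At each point the derivative of an inversion is a rotation plus a dilation; the first sum is the
rotation, the last term the dilation. -/
theorem slot_inversion (i l : Idx p q) (W : VField 𝕜 U) :
    ∑ k, pd 𝕜 U k (inversion 𝕜 U i l) * W k
      = (2 : 𝕜) • ∑ j, coord j * spin i j W l - (2 * metric 𝕜 p q i) • (coord i * W l) := by
  simp only [pd_inversion, smul_add, smul_ite, smul_zero, sub_mul, add_mul, ite_mul, zero_mul,
    Finset.sum_sub_distrib, Finset.sum_add_distrib, Finset.sum_ite_irrel, Finset.sum_const_zero,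
    Finset.sum_ite_eq', Finset.mem_univ, if_true, spin_apply, smul_mul_assoc, mul_sub, mul_ite,
    mul_zero, Finset.sum_ite_eq, mul_smul_comm, smul_sub, Finset.smul_sum, smul_smul]
  split_ifs <;> simp <;> abel

theorem metric_mul_mul_mul (i j : Idx p q) :
    metric 𝕜 p q i * metric 𝕜 p q j * (metric 𝕜 p q i * metric 𝕜 p q j) = 1 := by
  linear_combination metric 𝕜 p q j * metric 𝕜 p q j * metric_mul_self (𝕜 := 𝕜) i
    + metric_mul_self (𝕜 := 𝕜) j

/-- Up to normalization, this is the Casimir operator of o(p,q) on vectors. -/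
theorem sum_spin_spin (l : Idx p q) (W : VField 𝕜 U) :
    ∑ i, ∑ j, (metric 𝕜 p q i * metric 𝕜 p q j) • spin i j (spin i j W) l
      = (2 * (1 - (p + q : ℕ)) : 𝕜) • W l := by
  have h : ∀ x : Idx p q,
      metric 𝕜 p q l * metric 𝕜 p q x * (metric 𝕜 p q x * metric 𝕜 p q l) = 1 := fun x => by
    rw [mul_comm (metric 𝕜 p q x), metric_mul_mul_mul]
  simp only [spin_apply, smul_sub, smul_ite, smul_zero, Finset.sum_sub_distrib, smul_smul,
    Finset.sum_ite_irrel, Finset.sum_const_zero, Finset.sum_ite_eq, Finset.sum_ite_eq',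
    Finset.mem_univ, if_true, h, metric_mul_mul_mul, Finset.sum_const, Finset.card_univ,
    Fintype.card_sum, Fintype.card_fin]
  rw [← Nat.cast_smul_eq_nsmul 𝕜]
  module

/-- The cross term of the o(p,q) Casimir on two tensor slots is a contraction minus an exchange of
the slots; the exchange is trivial on symmetric tensors. -/
theorem sum_spin_spin_slots (l m : Idx p q) (P : Idx p q → VField 𝕜 U)
    (hP : ∀ i j, P i j = P j i) :
    ∑ i, ∑ j, (metric 𝕜 p q i * metric 𝕜 p q j) • spin i j (fun k => spin i j (P k) m) l
      = (2 : 𝕜) • (if l = m then metric 𝕜 p q l • ∑ k, metric 𝕜 p q k • P k k else 0)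
        - (2 : 𝕜) • P l m := by
  have h : ∀ x y : Idx p q,
      metric 𝕜 p q x * metric 𝕜 p q y * (metric 𝕜 p q y * metric 𝕜 p q x) = 1 := fun x y => by
    rw [mul_comm (metric 𝕜 p q y), metric_mul_mul_mul]
  have h' : ∀ x : Idx p q, metric 𝕜 p q l * metric 𝕜 p q x * (metric 𝕜 p q x * metric 𝕜 p q x)
      = metric 𝕜 p q l * metric 𝕜 p q x := fun x => by rw [metric_mul_self, mul_one]
  have h'' : ∀ x : Idx p q, metric 𝕜 p q x * metric 𝕜 p q l * (metric 𝕜 p q x * metric 𝕜 p q x)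
      = metric 𝕜 p q l * metric 𝕜 p q x := fun x => by
    rw [metric_mul_self, mul_one, mul_comm]
  simp only [spin_apply, smul_sub, smul_ite, smul_zero, Finset.sum_sub_distrib, smul_smul,
    Finset.sum_ite_irrel, Finset.sum_const_zero, Finset.sum_ite_eq,
    Finset.mem_univ, if_true, h, h', h'', metric_mul_mul_mul, hP m l, @eq_comm _ m l]
  simp only [mul_smul, ← Finset.smul_sum]
  split_ifs <;> module

/-! ### Eigenvalues of the Casimir operator on symbols -/

/-- The Casimir operator of the conformal Lie algebra on symbols. -/
def symbCasimir (δ : 𝕜) (P : Symb 𝕜 U) : Symb 𝕜 U :=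
  casimir (𝕜 := 𝕜) p q (fun i => lieSymb δ (translation 𝕜 U i))
    (fun i j => lieSymb δ (rotation 𝕜 U i j)) (lieSymb δ (homothety 𝕜 U))
    (fun i => lieSymb δ (inversion 𝕜 U i)) P

/-- The eigenvalue of the Casimir operator on symbols of degree zero. -/
def casimirZero (p q : ℕ) (δ : 𝕜) : 𝕜 :=
  ((p + q : ℕ) * δ) ^ 2 - (p + q : ℕ) * ((p + q : ℕ) * δ)

/-- The eigenvalue of the Casimir operator on symbols of degree one. -/
def casimirOne (p q : ℕ) (δ : 𝕜) : 𝕜 :=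
  ((p + q : ℕ) * δ - 1) ^ 2 - (p + q : ℕ) * ((p + q : ℕ) * δ - 1) - (1 - (p + q : ℕ))

/-- The eigenvalue of the Casimir operator on trace-free symbols of degree two. -/
def casimirTwo (p q : ℕ) (δ : 𝕜) : 𝕜 :=
  ((p + q : ℕ) * δ - 2) ^ 2 - (p + q : ℕ) * ((p + q : ℕ) * δ - 2) + 2 * (p + q : ℕ)

/-- Here `J` indexes the components of one homogeneous degree, and `c` is nδ minus that degree,
since each contravariant index lowers the weight under the homothety by 1. -/
theorem map_symbCasimir {J : Type*} (π : Symb 𝕜 U →ₗ[𝕜] (J → Smooth 𝕜 U))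
    (S : Idx p q → Idx p q → (J → Smooth 𝕜 U) →ₗ[𝕜] (J → Smooth 𝕜 U)) (δ c : 𝕜)
    (hSx : ∀ i j k v l, S i j (fun l => coord k * v l) l = coord k * S i j v l)
    (hSd : ∀ i j k v l, pd 𝕜 U k (S i j v l) = S i j (fun l => pd 𝕜 U k (v l)) l)
    (hS : ∀ i j v l, S i j v l = - S j i v l)
    (hT : ∀ i P l, π (lieSymb δ (translation 𝕜 U i) P) l = pd 𝕜 U i (π P l))
    (hR : ∀ i j P l, π (lieSymb δ (rotation 𝕜 U i j) P) l
      = metric 𝕜 p q i • (coord i * pd 𝕜 U j (π P l))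
        - metric 𝕜 p q j • (coord j * pd 𝕜 U i (π P l)) + S i j (π P) l)
    (hE : ∀ P l, π (lieSymb δ (homothety 𝕜 U) P) l
      = ∑ k, coord k * pd 𝕜 U k (π P l) + c • π P l)
    (hB : ∀ i P l, π (lieSymb δ (inversion 𝕜 U i) P) l
      = ∑ j, metric 𝕜 p q j • (coord j * (coord j * pd 𝕜 U i (π P l)))
        - (2 * metric 𝕜 p q i) • (coord i * (∑ k, coord k * pd 𝕜 U k (π P l) + c • π P l))
        - (2 : 𝕜) • ∑ j, coord j * S i j (π P) l) (P : Symb 𝕜 U) (l : J) :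
    π (symbCasimir δ P) l = (c ^ 2 - (p + q : ℕ) * c) • π P l
      - (1 / 2 : 𝕜) • ∑ i, ∑ j, (metric 𝕜 p q i * metric 𝕜 p q j) • S i j (S i j (π P)) l := by
  have key := map_casimir_eq π (fun k => (LinearMap.mulLeft 𝕜 (coord k)).compLeft J)
    (fun k => (pd 𝕜 U k).toLinearMap.compLeft J) S c
    (fun i j v => funext fun l => mul_left_comm _ _ _) (fun i j v => funext fun l => pd_comm i j _)
    (fun i j v => by
      funext l
      simp only [LinearMap.compLeft_apply, Function.comp_apply, Pi.add_apply,
        LinearMap.mulLeft_apply, Derivation.coeFn_coe, Derivation.leibniz, smul_eq_mul,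
        pd_coord, mul_ite, mul_one, mul_zero]
      split_ifs <;> rfl)
    (fun i j k v => funext fun l => hSx i j k v l) (fun i j k v => funext fun l => hSd i j k v l)
    (fun i j v => funext fun l => hS i j v l)
    (T := fun i => lieSymb δ (translation 𝕜 U i))
    (R := fun i j => lieSymb δ (rotation 𝕜 U i j)) (E := lieSymb δ (homothety 𝕜 U))
    (B := fun i => lieSymb δ (inversion 𝕜 U i))
    (fun i P => funext fun l => hT i P l) (fun i j P => funext fun l => hR i j P l)
    (fun P => funext fun l => by
      rw [hE]
      simp only [Pi.add_apply, Finset.sum_apply, Pi.smul_apply]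
      rfl)
    (fun i P => funext fun l => by
      rw [hB]
      simp only [Pi.sub_apply, Finset.sum_apply, Pi.smul_apply, LinearMap.compLeft_apply,
        Function.comp_apply, Pi.add_apply, LinearMap.mulLeft_apply, Derivation.coeFn_coe]) P
  have := congr_fun key l
  simp only [Pi.sub_apply, Pi.smul_apply, Finset.sum_apply] at this
  exact this

theorem c0_symbCasimir (δ : 𝕜) (P : Symb 𝕜 U) :
    c0 (symbCasimir δ P) = casimirZero p q δ • c0 P := by
  let π : Symb 𝕜 U →ₗ[𝕜] (Unit → Smooth 𝕜 U) := ⟨⟨fun P _ => c0 P, fun _ _ => rfl⟩, fun _ _ => rfl⟩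
  have key := map_symbCasimir π (fun _ _ => 0) δ ((p + q : ℕ) * δ)
    (fun i j k v l => (mul_zero _).symm) (fun i j k v l => map_zero _)
    (fun i j v l => neg_zero.symm)
    (fun i P _ => lieDensity_translation δ i (c0 P))
    (fun i j P _ => (lieDensity_rotation δ i j (c0 P)).trans (add_zero _).symm)
    (fun P _ => lieDensity_homothety δ (c0 P))
    (fun i P _ => (lieDensity_inversion δ i (c0 P)).trans (by
      simp only [LinearMap.zero_apply, Pi.zero_apply, mul_zero, Finset.sum_const_zero, smul_zero,
        sub_zero]
      rfl)) P ()
  simp only [LinearMap.zero_apply, Pi.zero_apply, smul_zero, Finset.sum_const_zero,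
    sub_zero] at key
  exact key

/-- Absorbs the dilation part of the index action into the weight: `c` is the number of indices. -/
theorem inversion_slot_identity (a b f s : Smooth 𝕜 U) (i : Idx p q) (w c : 𝕜) :
    a - (2 * metric 𝕜 p q i) • (coord i * (b + w • f))
        - ((2 : 𝕜) • s - (2 * metric 𝕜 p q i * c) • (coord i * f))
      = a - (2 * metric 𝕜 p q i) • (coord i * (b + (w - c) • f)) - (2 : 𝕜) • s := by
  simp only [mul_add, mul_smul_comm]
  module

theorem coord_mul_spin (i j k l : Idx p q) (v : VField 𝕜 U) :
    spin i j (fun l => coord k * v l) l = coord k * spin i j v l := by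
  simp only [spin_apply, mul_sub, mul_ite, mul_zero, mul_smul_comm]

theorem pd_spin (i j k l : Idx p q) (v : VField 𝕜 U) :
    pd 𝕜 U k (spin i j v l) = spin i j (fun l => pd 𝕜 U k (v l)) l := by
  simp only [spin_apply, map_sub, apply_ite (pd 𝕜 U k), map_zero, Derivation.map_smul]

theorem c1_lieSymb_apply (δ : 𝕜) (X : VField 𝕜 U) (P : Symb 𝕜 U) (l : Idx p q) :
    c1 (lieSymb δ X P) l = lieDensity δ X (c1 P l) - ∑ k, pd 𝕜 U k (X l) * c1 P k := rfl

theorem c2_lieSymb_apply (δ : 𝕜) (X : VField 𝕜 U) (P : Symb 𝕜 U) (l m : Idx p q) :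
    c2 (lieSymb δ X P) l m = lieDensity δ X (c2 P l m) - (∑ k, pd 𝕜 U k (X l) * c2 P k m
      + ∑ k, pd 𝕜 U k (X m) * c2 P l k) := by
  rw [← Finset.sum_add_distrib]; rfl

theorem c1_symbCasimir (δ : 𝕜) (P : Symb 𝕜 U) (l : Idx p q) :
    c1 (symbCasimir δ P) l = casimirOne p q δ • c1 P l := by
  let π : Symb 𝕜 U →ₗ[𝕜] (Idx p q → Smooth 𝕜 U) := ⟨⟨c1, fun _ _ => rfl⟩, fun _ _ => rfl⟩
  have hπ : ∀ P, π P = c1 P := fun _ => rfl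
  have key := map_symbCasimir π spin δ ((p + q : ℕ) * δ - 1)
    (fun i j k v l => coord_mul_spin i j k l v) (fun i j k v l => pd_spin i j k l v)
    (fun i j v l => spin_swap i j l v)
    (fun i P l => by
      rw [hπ, hπ, c1_lieSymb_apply]
      simp only [lieDensity_translation, pd_translation, zero_mul, Finset.sum_const_zero, sub_zero])
    (fun i j P l => by
      rw [hπ, hπ, c1_lieSymb_apply, lieDensity_rotation, slot_rotation, sub_neg_eq_add])
    (fun P l => by
      rw [hπ, hπ, c1_lieSymb_apply, lieDensity_homothety, slot_homothety]
      module)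
    (fun i P l => by
      rw [hπ, hπ, c1_lieSymb_apply, lieDensity_inversion, slot_inversion,
        ← inversion_slot_identity, mul_one]) P l
  rw [sum_spin_spin, hπ, hπ] at key
  rw [key, casimirOne]
  module

/-- The infinitesimal rotation in the `(i, j)`-plane of the values of contravariant two-tensors. -/
def spin2 (i j : Idx p q) :
    (Idx p q × Idx p q → Smooth 𝕜 U) →ₗ[𝕜] (Idx p q × Idx p q → Smooth 𝕜 U) where
  toFun P l := spin i j (fun k => P (k, l.2)) l.1 + spin i j (fun k => P (l.1, k)) l.2
  map_add' P R := by
    funext l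
    simp only [Pi.add_apply, spin_apply, smul_add]
    split_ifs <;> abel
  map_smul' c P := by
    funext l
    simp only [Pi.smul_apply, spin_apply, RingHom.id_apply]
    split_ifs <;> module

theorem spin2_apply (i j : Idx p q) (P : Idx p q × Idx p q → Smooth 𝕜 U) (l : Idx p q × Idx p q) :
    spin2 i j P l = spin i j (fun k => P (k, l.2)) l.1 + spin i j (fun k => P (l.1, k)) l.2 := rfl

theorem sum_spin2_spin2 (P : Idx p q × Idx p q → Smooth 𝕜 U) (hP : ∀ i j, P (i, j) = P (j, i))
    (l m : Idx p q) :
    ∑ i, ∑ j, (metric 𝕜 p q i * metric 𝕜 p q j) • spin2 i j (spin2 i j P) (l, m)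
      = (-4 * (p + q : ℕ) : 𝕜) • P (l, m)
        + (4 : 𝕜) • (if l = m then metric 𝕜 p q l • ∑ k, metric 𝕜 p q k • P (k, k) else 0) := by
  have h : ∀ i j, spin2 i j (spin2 i j P) (l, m)
      = spin i j (spin i j fun k => P (k, m)) l + spin i j (fun k => spin i j (fun r => P (k, r)) m) l
        + (spin i j (fun k => spin i j (fun r => P (r, k)) l) m
          + spin i j (spin i j fun k => P (l, k)) m) := fun i j => by
    rw [spin2_apply]
    simp only [spin2_apply]
    have e1 := map_add (spin (𝕜 := 𝕜) (U := U) i j) (spin i j fun k => P (k, m))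
      (fun k => spin i j (fun r => P (k, r)) m)
    have e2 := map_add (spin (𝕜 := 𝕜) (U := U) i j) (fun k => spin i j (fun r => P (r, k)) l)
      (spin i j fun k => P (l, k))
    exact congr_arg₂ (· + ·) (congr_fun e1 l) (congr_fun e2 m)
  simp only [h, smul_add, Finset.sum_add_distrib, sum_spin_spin]
  rw [sum_spin_spin_slots l m (fun k r => P (k, r)) hP,
    sum_spin_spin_slots m l (fun k r => P (r, k)) (fun i j => hP j i)]
  by_cases hlm : l = m
  · subst hlm
    simp only [if_true]
    module
  · simp only [hlm, Ne.symm hlm, if_false]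
    module

theorem casimirTwo_identity {M : Type*} [AddCommGroup M] [Module 𝕜 M] (δ : 𝕜) (a b : M) :
    (((p + q : ℕ) * δ - 2) ^ 2 - (p + q : ℕ) * ((p + q : ℕ) * δ - 2) : 𝕜) • a
      - (1 / 2 : 𝕜) • ((-4 * (p + q : ℕ) : 𝕜) • a + (4 : 𝕜) • b)
      = casimirTwo p q δ • a - (2 : 𝕜) • b := by
  rw [casimirTwo]
  module

theorem c2_symbCasimir (δ : 𝕜) (P : Symb 𝕜 U) (l m : Idx p q) :
    c2 (symbCasimir δ P) l m = casimirTwo p q δ • c2 P l m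
      - (2 : 𝕜) • if l = m then metric 𝕜 p q l • trace P else 0 := by
  let π : Symb 𝕜 U →ₗ[𝕜] (Idx p q × Idx p q → Smooth 𝕜 U) :=
    ⟨⟨fun P l => c2 P l.1 l.2, fun _ _ => rfl⟩, fun _ _ => rfl⟩
  have hπ : ∀ P l, π P l = c2 P l.1 l.2 := fun _ _ => rfl
  have key := map_symbCasimir π spin2 δ ((p + q : ℕ) * δ - 2)
    (fun i j k v l => by
      rw [spin2_apply, spin2_apply, mul_add, ← coord_mul_spin, ← coord_mul_spin])
    (fun i j k v l => by
      rw [spin2_apply, spin2_apply, map_add, pd_spin, pd_spin])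
    (fun i j v l => by
      rw [spin2_apply, spin2_apply, spin_swap, spin_swap i j l.2, neg_add])
    (fun i P l => by
      rw [hπ, hπ, c2_lieSymb_apply]
      simp only [lieDensity_translation, pd_translation, zero_mul, Finset.sum_const_zero, sub_zero,
        add_zero])
    (fun i j P l => by
      rw [hπ, hπ, c2_lieSymb_apply, lieDensity_rotation, slot_rotation i j l.1 (fun k => c2 P k l.2),
        slot_rotation, spin2_apply, ← neg_add, sub_neg_eq_add]
      rfl)
    (fun P l => by
      rw [hπ, hπ, c2_lieSymb_apply, lieDensity_homothety, slot_homothety l.1 (fun k => c2 P k l.2),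
        slot_homothety]
      module)
    (fun i P l => by
      simp only [hπ, spin2_apply]
      rw [c2_lieSymb_apply, lieDensity_inversion, slot_inversion i l.1 (fun k => c2 P k l.2),
        slot_inversion, ← inversion_slot_identity]
      simp only [mul_add, Finset.sum_add_distrib, smul_add]
      module) P (l, m)
  rw [sum_spin2_spin2 (π P) (fun i j => c2_symm P i j)] at key
  exact key.trans (casimirTwo_identity δ (c2 P l m)
    (if l = m then metric 𝕜 p q l • trace P else 0))

/-! ### Rigidity of degree-lowering intertwiners -/

theorem translation_mem_confAlg (i : Idx p q) : translation 𝕜 U i ∈ confAlg 𝕜 U :=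
  Submodule.subset_span (Or.inl (Or.inl (Or.inl ⟨i, rfl⟩)))

theorem rotation_mem_confAlg (i j : Idx p q) : rotation 𝕜 U i j ∈ confAlg 𝕜 U :=
  Submodule.subset_span (Or.inl (Or.inl (Or.inr ⟨(i, j), rfl⟩)))

theorem homothety_mem_confAlg : homothety 𝕜 U ∈ confAlg 𝕜 U :=
  Submodule.subset_span (Or.inl (Or.inr rfl))

theorem inversion_mem_confAlg (i : Idx p q) : inversion 𝕜 U i ∈ confAlg 𝕜 U :=
  Submodule.subset_span (Or.inr ⟨i, rfl⟩)

theorem map_symbCasimir_comm (δ : 𝕜) (N : Symb 𝕜 U →ₗ[𝕜] Symb 𝕜 U)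
    (hN : ∀ X ∈ confAlg 𝕜 U, ∀ P, N (lieSymb δ X P) = lieSymb δ X (N P)) (P : Symb 𝕜 U) :
    N (symbCasimir δ P) = symbCasimir δ (N P) :=
  map_casimir N (fun i => hN _ (translation_mem_confAlg i))
    (fun i j => hN _ (rotation_mem_confAlg i j)) (hN _ homothety_mem_confAlg)
    (fun i => hN _ (inversion_mem_confAlg i)) P

theorem symbCasimir_linear (δ : 𝕜) {P : Symb 𝕜 U} (h2 : c2 P = 0) (h0 : c0 P = 0) :
    symbCasimir δ P = casimirOne p q δ • P := by
  refine symb_ext (fun i j => ?_) (fun i => c1_symbCasimir δ P i) ?_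
  · rw [c2_symbCasimir, trace_eq_zero h2, h2]
    change _ = casimirOne p q δ • c2 P i j
    simp [h2]
  · rw [c0_symbCasimir, h0, smul_zero]
    change _ = casimirOne p q δ • c0 P
    rw [h0, smul_zero]

theorem trace_symbCasimir (δ : 𝕜) (P : Symb 𝕜 U) :
    trace (symbCasimir δ P) = (casimirTwo p q δ - 2 * (p + q : ℕ)) • trace P := by
  simp only [trace, c2_symbCasimir, if_true, smul_sub, Finset.sum_sub_distrib,
    smul_comm (metric 𝕜 p q _) (2 : 𝕜), metric_smul_metric_smul, Finset.sum_const,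
    Finset.card_univ, Fintype.card_sum, Fintype.card_fin]
  simp only [smul_comm (metric 𝕜 p q _) (casimirTwo p q δ), ← Finset.smul_sum]
  rw [← Nat.cast_smul_eq_nsmul 𝕜]
  module

/-- The roots are the eigenvalues on trace-free and on pure-trace symbols. Using the polynomial
avoids decomposing P₂. -/
theorem symbCasimir_quadratic (δ : 𝕜) {P : Symb 𝕜 U} (h1 : c1 P = 0) (h0 : c0 P = 0) :
    symbCasimir δ (symbCasimir δ P)
      = (2 * casimirTwo p q δ - 2 * (p + q : ℕ)) • symbCasimir δ P
        + (-(casimirTwo p q δ * (casimirTwo p q δ - 2 * (p + q : ℕ)))) • P := by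
  refine symb_ext (fun i j => ?_) (fun i => ?_) ?_
  · change _ = (2 * casimirTwo p q δ - 2 * (p + q : ℕ)) • c2 (symbCasimir δ P) i j
        + (-(casimirTwo p q δ * (casimirTwo p q δ - 2 * (p + q : ℕ)))) • c2 P i j
    rw [c2_symbCasimir, c2_symbCasimir, trace_symbCasimir]
    split_ifs <;> module
  · change _ = (2 * casimirTwo p q δ - 2 * (p + q : ℕ)) • c1 (symbCasimir δ P) i
        + (-(casimirTwo p q δ * (casimirTwo p q δ - 2 * (p + q : ℕ)))) • c1 P i
    rw [c1_symbCasimir, c1_symbCasimir, h1]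
    simp
  · change _ = (2 * casimirTwo p q δ - 2 * (p + q : ℕ)) • c0 (symbCasimir δ P)
        + (-(casimirTwo p q δ * (casimirTwo p q δ - 2 * (p + q : ℕ)))) • c0 P
    rw [c0_symbCasimir, c0_symbCasimir, h0]
    simp

theorem c1_smul_add_smul (a b : 𝕜) (P R : Symb 𝕜 U) (i : Idx p q) :
    c1 (a • P + b • R) i = a • c1 P i + b • c1 R i := rfl

theorem c0_smul_add_smul (a b : 𝕜) (P R : Symb 𝕜 U) :
    c0 (a • P + b • R) = a • c0 P + b • c0 R := rfl

theorem eq_zero_of_quadratic {M : Type*} [AddCommGroup M] [Module 𝕜 M]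
    {a b c : 𝕜} {m : M} (hab : a ≠ b) (hac : a ≠ b - c)
    (h : a • a • m = (2 * b - c) • a • m + (-(b * (b - c))) • m) : m = 0 := by
  have h' : ((a - b) * (a - (b - c))) • m = 0 := by
    linear_combination (norm := module) h
  exact (smul_eq_zero.1 h').resolve_left (mul_ne_zero (sub_ne_zero.2 hab) (sub_ne_zero.2 hac))

theorem eq_zero_of_symbCasimir_quadratic {δ b c : 𝕜} {P : Symb 𝕜 U} (h2 : c2 P = 0)
    (h1b : casimirOne p q δ ≠ b) (h1c : casimirOne p q δ ≠ b - c)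
    (h0b : casimirZero p q δ ≠ b) (h0c : casimirZero p q δ ≠ b - c)
    (h : symbCasimir δ (symbCasimir δ P)
      = (2 * b - c) • symbCasimir δ P + (-(b * (b - c))) • P) : P = 0 := by
  refine symb_ext (fun i j => congr_fun (congr_fun h2 i) j) (fun i => ?_) ?_
  · have h' := congr_arg (fun R => c1 R i) h
    beta_reduce at h'
    rw [c1_smul_add_smul, c1_symbCasimir, c1_symbCasimir] at h'
    exact eq_zero_of_quadratic h1b h1c h'
  · have h' := congr_arg c0 h
    rw [c0_smul_add_smul, c0_symbCasimir, c0_symbCasimir] at h'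
    exact eq_zero_of_quadratic h0b h0c h'

section Lowering

theorem map_smul_add_smul {M : Type*} [AddCommMonoid M] [Module 𝕜 M] (N : M →ₗ[𝕜] M) (a b : 𝕜)
    (u v : M) : N (a • u + b • v) = a • N u + b • N v := by
  rw [map_add, map_smul, map_smul]

theorem map_add_add_eq_zero {M : Type*} [AddCommMonoid M] [Module 𝕜 M] (N : M →ₗ[𝕜] M)
    {u v w : M} (hu : N u = 0) (hv : N v = 0) (hw : N w = 0) : N (u + v + w) = 0 := by
  rw [map_add, map_add, hu, hv, hw, add_zero, add_zero]

variable {δ : 𝕜} {N : Symb 𝕜 U →ₗ[𝕜] Symb 𝕜 U} {P : Symb 𝕜 U}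

theorem eq_zero_of_linear (hC : N (symbCasimir δ P) = symbCasimir δ (N P))
    (h10 : casimirOne p q δ ≠ casimirZero p q δ) (h2 : c2 P = 0) (h0 : c0 P = 0)
    (hN2 : c2 (N P) = 0) (hN1 : c1 (N P) = 0) : N P = 0 := by
  refine symb_ext (fun i j => congr_fun (congr_fun hN2 i) j) (fun i => congr_fun hN1 i) ?_
  have h := congr_arg c0 hC
  rw [symbCasimir_linear δ h2 h0, map_smul, c0_symbCasimir] at h
  change casimirOne p q δ • c0 (N P) = _ at h
  rw [← sub_eq_zero, ← sub_smul] at h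
  exact (smul_eq_zero.1 h).resolve_left (sub_ne_zero.2 h10)

/-- `N P` inherits the quadratic relation of `P`, but its components of degree 1 and 0 have
eigenvalues that are not roots. -/
theorem eq_zero_of_homogeneous_two
    (hC : ∀ P, N (symbCasimir δ P) = symbCasimir δ (N P))
    (h21 : casimirOne p q δ ≠ casimirTwo p q δ)
    (h21' : casimirOne p q δ ≠ casimirTwo p q δ - 2 * (p + q : ℕ))
    (h20 : casimirZero p q δ ≠ casimirTwo p q δ)
    (h20' : casimirZero p q δ ≠ casimirTwo p q δ - 2 * (p + q : ℕ))
    (h1 : c1 P = 0) (h0 : c0 P = 0) (hN2 : c2 (N P) = 0) : N P = 0 := by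
  refine eq_zero_of_symbCasimir_quadratic hN2 h21 h21' h20 h20' ?_
  rw [← hC, ← hC, symbCasimir_quadratic δ h1 h0]
  exact map_smul_add_smul N _ _ _ _

theorem exists_eq_add_homogeneous (P : Symb 𝕜 U) : ∃ P2 P1 P0 : Symb 𝕜 U, P = P2 + P1 + P0 ∧
    (c1 P2 = 0 ∧ c0 P2 = 0) ∧ (c2 P1 = 0 ∧ c0 P1 = 0) ∧ (c2 P0 = 0 ∧ c1 P0 = 0) := by
  refine ⟨⟨(c2 P, 0, 0), P.2⟩, ⟨(0, c1 P, 0), fun _ _ => rfl⟩, ⟨(0, 0, c0 P), fun _ _ => rfl⟩,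
    symb_ext (fun i j => ?_) (fun i => ?_) ?_, ⟨rfl, rfl⟩, ⟨rfl, rfl⟩, ⟨rfl, rfl⟩⟩
  · change c2 P i j = c2 P i j + 0 + 0
    rw [add_zero, add_zero]
  · change c1 P i = 0 + c1 P i + 0
    rw [add_zero, zero_add]
  · change c0 P = 0 + 0 + c0 P
    rw [add_zero, zero_add]

/-- A map of symbols that commutes with the conformal Lie algebra and lowers the degree vanishes
off the resonances. -/
theorem eq_zero_of_symbLT
    (hN : ∀ X ∈ confAlg 𝕜 U, ∀ P, N (lieSymb δ X P) = lieSymb δ X (N P))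
    (hlow : ∀ k, ∀ P ∈ symbLT 𝕜 U (k + 1), N P ∈ symbLT 𝕜 U k)
    (h10 : casimirOne p q δ ≠ casimirZero p q δ) (h21 : casimirOne p q δ ≠ casimirTwo p q δ)
    (h21' : casimirOne p q δ ≠ casimirTwo p q δ - 2 * (p + q : ℕ))
    (h20 : casimirZero p q δ ≠ casimirTwo p q δ)
    (h20' : casimirZero p q δ ≠ casimirTwo p q δ - 2 * (p + q : ℕ)) (P : Symb 𝕜 U) :
    N P = 0 := by
  have hC := map_symbCasimir_comm δ N hN
  have hlow2 : ∀ P, c2 (N P) = 0 := fun P =>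
    (hlow 2 P ⟨by omega, by omega, by omega⟩).1 le_rfl
  have hlow1 : ∀ P, c2 P = 0 → c1 (N P) = 0 := fun P h =>
    (hlow 1 P ⟨fun _ => h, by omega, by omega⟩).2.1 le_rfl
  have hlow0 : ∀ P, c2 P = 0 → c1 P = 0 → c0 (N P) = 0 := fun P h h' =>
    (hlow 0 P ⟨fun _ => h, fun _ => h', by omega⟩).2.2 le_rfl
  obtain ⟨P2, P1, P0, hP, ⟨h21P, h20P⟩, ⟨h12P, h10P⟩, h02P, h01P⟩ := exists_eq_add_homogeneous P
  have e0 : N P0 = 0 := symb_ext (fun i j => congr_fun (congr_fun (hlow2 P0) i) j)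
    (fun i => congr_fun (hlow1 P0 h02P) i) (hlow0 P0 h02P h01P)
  rw [hP]
  exact map_add_add_eq_zero N
    (eq_zero_of_homogeneous_two hC h21 h21' h20 h20' h21P h20P (hlow2 P2))
    (eq_zero_of_linear (hC P1) h10 h12P h10P (hlow2 P1) (hlow1 P1 h12P)) e0

end Lowering

/-! ### Linearity of the action, and locality through ideals of vanishing functions -/

theorem lieSymb_add (δ : 𝕜) (X : VField 𝕜 U) (P R : Symb 𝕜 U) :
    lieSymb δ X (P + R) = lieSymb δ X P + lieSymb δ X R := by
  refine symb_ext (fun i j => ?_) (fun i => ?_) (map_add (lieDensity δ X) (c0 P) (c0 R))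
  · change _ = c2 (lieSymb δ X P) i j + c2 (lieSymb δ X R) i j
    rw [c2_lieSymb_apply, c2_lieSymb_apply, c2_lieSymb_apply]
    have : c2 (P + R) = c2 P + c2 R := rfl
    simp only [this, Pi.add_apply, map_add, mul_add, Finset.sum_add_distrib]
    abel
  · change _ = c1 (lieSymb δ X P) i + c1 (lieSymb δ X R) i
    rw [c1_lieSymb_apply, c1_lieSymb_apply, c1_lieSymb_apply]
    have : c1 (P + R) = c1 P + c1 R := rfl
    simp only [this, Pi.add_apply, map_add, mul_add, Finset.sum_add_distrib]
    abel

theorem lieSymb_smul (δ c : 𝕜) (X : VField 𝕜 U) (P : Symb 𝕜 U) :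
    lieSymb δ X (c • P) = c • lieSymb δ X P := by
  refine symb_ext (fun i j => ?_) (fun i => ?_) (map_smul (lieDensity δ X) c (c0 P))
  · change _ = c • c2 (lieSymb δ X P) i j
    rw [c2_lieSymb_apply, c2_lieSymb_apply]
    have : c2 (c • P) = c • c2 P := rfl
    simp only [this, Pi.smul_apply, map_smul, mul_smul_comm, smul_sub, smul_add, Finset.smul_sum]
  · change _ = c • c1 (lieSymb δ X P) i
    rw [c1_lieSymb_apply, c1_lieSymb_apply]
    have : c1 (c • P) = c • c1 P := rfl
    simp only [this, Pi.smul_apply, map_smul, mul_smul_comm, smul_sub, Finset.smul_sum]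

/-- The ideal of smooth functions that vanish on `W`. -/
def vanishingIdeal (W : Set U) : Ideal (Smooth 𝕜 U) where
  carrier := {f | ∀ x ∈ W, (f : U → 𝕜) x = 0}
  add_mem' {f h} hf hh x hx := by
    change (f : U → 𝕜) x + (h : U → 𝕜) x = 0
    rw [hf x hx, hh x hx, add_zero]
  zero_mem' x _ := rfl
  smul_mem' c f hf x hx := by
    change (c : U → 𝕜) x * (f : U → 𝕜) x = 0
    rw [hf x hx, mul_zero]

theorem smul_mem_vanishingIdeal {W : Set U} (c : 𝕜) {f : Smooth 𝕜 U}
    (hf : f ∈ vanishingIdeal (𝕜 := 𝕜) W) : c • f ∈ vanishingIdeal (𝕜 := 𝕜) W :=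
  Submodule.smul_of_tower_mem _ c hf

theorem pd_mem_vanishingIdeal {W : Set U} (hW : IsOpen W) {f : Smooth 𝕜 U}
    (hf : f ∈ vanishingIdeal (𝕜 := 𝕜) W) (i : Idx p q) :
    pd 𝕜 U i f ∈ vanishingIdeal (𝕜 := 𝕜) W :=
  pd_eq_zero_of_eqOn hW hf i

theorem op_mem_vanishingIdeal {W : Set U} {A : Symb 𝕜 U}
    (h2 : ∀ i j, c2 A i j ∈ vanishingIdeal (𝕜 := 𝕜) W)
    (h1 : ∀ i, c1 A i ∈ vanishingIdeal (𝕜 := 𝕜) W) (h0 : c0 A ∈ vanishingIdeal (𝕜 := 𝕜) W)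
    (f : Smooth 𝕜 U) : op A f ∈ vanishingIdeal (𝕜 := 𝕜) W := by
  rw [op_apply]
  exact add_mem (add_mem (sum_mem fun i _ => sum_mem fun j _ => Ideal.mul_mem_right _ _ (h2 i j))
    (sum_mem fun i _ => Ideal.mul_mem_right _ _ (h1 i))) (Ideal.mul_mem_right _ _ h0)

theorem divergence_mem_vanishingIdeal {W : Set U} (hW : IsOpen W) {V : VField 𝕜 U}
    (hV : ∀ i, V i ∈ vanishingIdeal (𝕜 := 𝕜) W) : divergence V ∈ vanishingIdeal (𝕜 := 𝕜) W :=
  sum_mem fun i _ => pd_mem_vanishingIdeal hW (hV i) i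

theorem op_quantEquiv_mem_vanishingIdeal (α β₁ β₂ β₃ β₄ : 𝕜) {W : Set U} (hW : IsOpen W)
    {P : Symb 𝕜 U} (h2 : ∀ i j, c2 P i j ∈ vanishingIdeal (𝕜 := 𝕜) W)
    (h1 : ∀ i, c1 P i ∈ vanishingIdeal (𝕜 := 𝕜) W) (h0 : c0 P ∈ vanishingIdeal (𝕜 := 𝕜) W)
    (f : Smooth 𝕜 U) :
    op (quantEquiv (U := U) α β₁ β₂ β₃ β₄ P) f ∈ vanishingIdeal (𝕜 := 𝕜) W := by
  have hd : ∀ i, div2 P i ∈ vanishingIdeal (𝕜 := 𝕜) W := fun i =>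
    sum_mem fun j _ => pd_mem_vanishingIdeal hW (h2 i j) j
  have ht : trace P ∈ vanishingIdeal (𝕜 := 𝕜) W :=
    sum_mem fun k _ => smul_mem_vanishingIdeal _ (h2 k k)
  have hg : ∀ i, grad (trace P) i ∈ vanishingIdeal (𝕜 := 𝕜) W := fun i =>
    smul_mem_vanishingIdeal _ (pd_mem_vanishingIdeal hW ht i)
  rw [quantEquiv_apply, map_add, LinearMap.add_apply]
  refine add_mem (op_mem_vanishingIdeal h2 h1 h0 f) (op_mem_vanishingIdeal (fun i j => ?_)
    (fun i => ?_) ?_ f)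
  · exact zero_mem _
  · exact add_mem (smul_mem_vanishingIdeal _ (hd i)) (smul_mem_vanishingIdeal _ (hg i))
  · exact add_mem (add_mem
      (smul_mem_vanishingIdeal _ (divergence_mem_vanishingIdeal hW h1))
      (smul_mem_vanishingIdeal _ (divergence_mem_vanishingIdeal hW hd)))
      (smul_mem_vanishingIdeal _ (divergence_mem_vanishingIdeal hW hg))

/-! ### The quantization map and its uniqueness -/

/-- The quantization map. -/
def quantization (α β₁ β₂ β₃ β₄ : 𝕜) : Symb 𝕜 U ≃ₗ[𝕜] DiffOp2 𝕜 U :=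
  (quantEquiv α β₁ β₂ β₃ β₄).trans (LinearEquiv.ofInjective op op_injective)

theorem isLocalMap_quantization (α β₁ β₂ β₃ β₄ : 𝕜) :
    IsLocalMap (quantization (U := U) α β₁ β₂ β₃ β₄).toLinearMap := fun _ hW _ hP f =>
  op_quantEquiv_mem_vanishingIdeal α β₁ β₂ β₃ β₄ hW (fun i j x hx => (hP x hx).1 i j)
    (fun i x hx => (hP x hx).2.1 i) (fun x hx => (hP x hx).2.2) f

theorem preservesPrincipalSymbol_quantization (α β₁ β₂ β₃ β₄ : 𝕜) :
    PreservesPrincipalSymbol (quantization (U := U) α β₁ β₂ β₃ β₄).toLinearMap := by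
  intro k P hP
  refine ⟨quantLower α β₁ β₂ β₃ β₄ P, ⟨fun _ => rfl, fun hk => ?_, fun hk => ?_⟩,
    map_add op P (quantLower α β₁ β₂ β₃ β₄ P)⟩
  · exact c1_quantLower_eq_zero _ _ _ _ _ (hP.1 (by omega))
  · exact c0_quantLower_eq_zero _ _ _ _ _ (hP.1 (by omega)) (hP.2.1 (by omega))

theorem confEquivariant_quantization {lam mu α β₁ β₂ β₃ β₄ : 𝕜}
    (hα : α * (1 - (mu - lam)) = lam)
    (h₁ : β₁ * (2 + (p + q : ℕ) * (1 - (mu - lam))) = 2 * (1 + (p + q : ℕ) * lam))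
    (h₂ : β₁ + β₂ * ((p + q : ℕ) * (mu - lam) - 2) = 1)
    (h₃ : β₃ * (2 + 2 * (p + q : ℕ) * (1 - (mu - lam))) = lam * (p + q : ℕ) * β₁)
    (h₄ : β₃ + β₄ * ((p + q : ℕ) * (2 * (mu - lam) - 1) - 2) = - (lam * (p + q : ℕ) * β₂)) :
    ConfEquivariant lam mu (quantization (U := U) α β₁ β₂ β₃ β₄).toLinearMap := by
  intro X hX P
  obtain ⟨φ, hφ⟩ := exists_isConformal hX
  have h := hφ.quantEquiv_lieSymb hα h₁ h₂ h₃ h₄ P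
  exact (congr_arg op h).trans (lieOp_op lam mu X _).symm

/-- For `R` = Q⁻¹Q'P: two maps with the same principal symbol differ, after inverting one, by a
degree-lowering map. -/
theorem sub_mem_symbLT (α β₁ β₂ β₃ β₄ : 𝕜) {k : ℕ} {P R B : Symb 𝕜 U}
    (hP : P ∈ symbLT 𝕜 U (k + 1)) (hB : B ∈ symbLT 𝕜 U k)
    (h : quantEquiv (U := U) α β₁ β₂ β₃ β₄ R = P + B) : R + (-1 : 𝕜) • P ∈ symbLT 𝕜 U k := by
  have h2 : c2 R + 0 = c2 P + c2 B := congr_arg c2 h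
  have h1 : c1 R + c1 (quantLower α β₁ β₂ β₃ β₄ R) = c1 P + c1 B := congr_arg c1 h
  have h0 : c0 R + c0 (quantLower α β₁ β₂ β₃ β₄ R) = c0 P + c0 B := congr_arg c0 h
  rw [add_zero] at h2
  have e2 : k ≤ 2 → c2 R = c2 P := fun hk => by rw [h2, hB.1 hk, add_zero]
  have e1 : k ≤ 1 → c1 R = c1 P := fun hk => by
    have : c2 R = 0 := by rw [e2 (by omega), hP.1 (by omega)]
    rw [c1_quantLower_eq_zero _ _ _ _ _ this, hB.2.1 hk, add_zero, add_zero] at h1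
    exact h1
  refine ⟨fun hk => ?_, fun hk => ?_, fun hk => ?_⟩
  · change c2 R + (-1 : 𝕜) • c2 P = 0
    rw [e2 hk]; module
  · change c1 R + (-1 : 𝕜) • c1 P = 0
    rw [e1 hk]; module
  · change c0 R + (-1 : 𝕜) • c0 P = 0
    have h2R : c2 R = 0 := by rw [e2 (by omega), hP.1 (by omega)]
    have h1R : c1 R = 0 := by rw [e1 (by omega), hP.2.1 (by omega)]
    rw [c0_quantLower_eq_zero _ _ _ _ _ h2R h1R, hB.2.2 hk, add_zero, add_zero] at h0
    rw [h0]; module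

/-- The map `M - 1`, for modules over a ring whose additive group structure is not at hand. -/
def subId {V : Type*} [AddCommMonoid V] [Module 𝕜 V] (M : V →ₗ[𝕜] V) : V →ₗ[𝕜] V :=
  M + (-1 : 𝕜) • LinearMap.id

theorem eq_of_subId_eq_zero {V : Type*} [AddCommMonoid V] [Module 𝕜 V] {M : V →ₗ[𝕜] V} {v : V}
    (h : subId M v = 0) : M v = v := by
  have h' : M v + (-1 : 𝕜) • v = 0 := h
  calc M v = (M v + (-1 : 𝕜) • v) + v := by module
    _ = v := by rw [h', zero_add]

theorem subId_lieSymb {δ : 𝕜} {X : VField 𝕜 U} {M : Symb 𝕜 U →ₗ[𝕜] Symb 𝕜 U} {P : Symb 𝕜 U}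
    (h : M (lieSymb δ X P) = lieSymb δ X (M P)) :
    subId M (lieSymb δ X P) = lieSymb δ X (subId M P) := by
  change M (lieSymb δ X P) + (-1 : 𝕜) • lieSymb δ X P = lieSymb δ X (M P + (-1 : 𝕜) • P)
  rw [h, lieSymb_add, lieSymb_smul]

set_option maxHeartbeats 1000000 in
theorem eq_quantization {lam mu α β₁ β₂ β₃ β₄ : 𝕜}
    (hQ : ConfEquivariant lam mu (quantization (U := U) α β₁ β₂ β₃ β₄).toLinearMap)
    (h10 : casimirOne p q (mu - lam) ≠ casimirZero p q (mu - lam))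
    (h21 : casimirOne p q (mu - lam) ≠ casimirTwo p q (mu - lam))
    (h21' : casimirOne p q (mu - lam) ≠ casimirTwo p q (mu - lam) - 2 * (p + q : ℕ))
    (h20 : casimirZero p q (mu - lam) ≠ casimirTwo p q (mu - lam))
    (h20' : casimirZero p q (mu - lam) ≠ casimirTwo p q (mu - lam) - 2 * (p + q : ℕ))
    {Q' : Symb 𝕜 U →ₗ[𝕜] DiffOp2 𝕜 U} (hQ' : ConfEquivariant lam mu Q')
    (hS : PreservesPrincipalSymbol Q') :
    Q' = (quantization (U := U) α β₁ β₂ β₃ β₄).toLinearMap := by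
  let Q := quantization (U := U) α β₁ β₂ β₃ β₄
  let M : Symb 𝕜 U →ₗ[𝕜] Symb 𝕜 U := Q.symm.toLinearMap ∘ₗ Q'
  have hQM : ∀ P, Q (M P) = Q' P := fun P => Q.apply_symm_apply (Q' P)
  have hM : ∀ X ∈ confAlg 𝕜 U, ∀ P, M (lieSymb (mu - lam) X P) = lieSymb (mu - lam) X (M P) := by
    intro X hX P
    apply Q.injective
    rw [hQM]
    apply Subtype.ext
    rw [hQ' X hX P, ← hQM]
    exact (hQ X hX (M P)).symm
  have hN := eq_zero_of_symbLT (N := subId M) (δ := mu - lam)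
    (fun X hX P => subId_lieSymb (hM X hX P))
    (fun k P hP => by
      obtain ⟨B, hB, h⟩ := hS k P hP
      refine sub_mem_symbLT α β₁ β₂ β₃ β₄ (P := P) (R := M P) hP hB (op_injective ?_)
      rw [map_add, ← h, ← hQM]
      rfl) h10 h21 h21' h20 h20'
  refine LinearMap.ext fun P => ?_
  have hMP : M P = P := eq_of_subId_eq_zero (hN P)
  rw [← hQM, hMP]
  rfl

end ConfQuant

end

open ConfQuant in
theorem theorem3p2 {𝕜 : Type*} [RCLike 𝕜] (p q n : ℕ) (hn : n = p + q) (hpos : 1 ≤ n)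
    (U : TopologicalSpace.Opens (Coord p q)) (lam mu δ : 𝕜) (hδ : δ = mu - lam)
    (hres : δ ∉ ({2 / (n : 𝕜), ((n : 𝕜) + 2) / (2 * n), 1, ((n : 𝕜) + 1) / n,
      ((n : 𝕜) + 2) / n} : Set 𝕜))
    (α β₁ β₂ β₃ β₄ : 𝕜)
    (hα : α = lam / (1 - δ))
    (hβ₁ : β₁ = 2 * (n * lam + 1) / (2 + n * (1 - δ)))
    (hβ₂ : β₂ = n * (lam + mu - 1) / ((2 + n * (1 - δ)) * (2 - n * δ)))
    (hβ₃ : β₃ = n * lam * (n * lam + 1) / ((1 + n * (1 - δ)) * (2 + n * (1 - δ))))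
    (hβ₄ : β₄ = n * lam * (n ^ 2 * mu * (2 - lam - mu) + 2 * (n * lam + 1) ^ 2 - n * (n + 1)) /
      ((1 + n * (1 - δ)) * (2 + n * (1 - δ)) * (2 + n * (1 - 2 * δ)) * (2 - n * δ))) :
    ∃ Q : Symb 𝕜 U ≃ₗ[𝕜] DiffOp2 𝕜 U,
      (ConfEquivariant lam mu Q.toLinearMap ∧ PreservesPrincipalSymbol Q.toLinearMap ∧
        IsLocalMap Q.toLinearMap) ∧
      (∀ P : Symb 𝕜 U, ∃ A : Symb 𝕜 U,
        (Q P : Module.End 𝕜 (Smooth 𝕜 U)) = op A ∧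
        (∀ i j, c2 A i j = c2 P i j) ∧
        (∀ i, c1 A i = c1 P i + β₁ • ∑ j, pd 𝕜 U j (c2 P i j)
          + β₂ • metric 𝕜 p q i • pd 𝕜 U i (∑ k, metric 𝕜 p q k • c2 P k k)) ∧
        c0 A = c0 P + α • ∑ i, pd 𝕜 U i (c1 P i) + β₃ • ∑ i, ∑ j, pd 𝕜 U i (pd 𝕜 U j (c2 P i j))
          + β₄ • ∑ i, metric 𝕜 p q i • pd 𝕜 U i (pd 𝕜 U i (∑ k, metric 𝕜 p q k • c2 P k k))) ∧
      ∀ Q' : Symb 𝕜 U →ₗ[𝕜] DiffOp2 𝕜 U, ConfEquivariant lam mu Q' →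
        PreservesPrincipalSymbol Q' → (Convex ℝ (U : Set (Coord p q)) ∨ IsLocalMap Q') →
        Q' = Q.toLinearMap := by

  subst hδ hn
  have hn0 : ((p + q : ℕ) : 𝕜) ≠ 0 := Nat.cast_ne_zero.2 (by omega)
  simp only [Set.mem_insert_iff, Set.mem_singleton_iff, not_or] at hres
  obtain ⟨r1, r2, r3, r4, r5⟩ := hres
  -- From the five excluded values come the nonvanishing factors that serve both as denominators of
  -- the coefficients and as eigenvalue gaps.
  generalize hN : ((p + q : ℕ) : 𝕜) = N at *
  have s1 : 2 - N * (mu - lam) ≠ 0 := fun h => r1 (by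
    rw [eq_div_iff hn0]; linear_combination -h)
  have s2 : 2 + N * (1 - 2 * (mu - lam)) ≠ 0 := fun h => r2 (by
    rw [eq_div_iff (mul_ne_zero two_ne_zero hn0)]; linear_combination -h)
  have s3 : 1 - (mu - lam) ≠ 0 := fun h => r3 (by linear_combination -h)
  have s4 : 1 + N * (1 - (mu - lam)) ≠ 0 := fun h => r4 (by
    rw [eq_div_iff hn0]; linear_combination -h)
  have s5 : 2 + N * (1 - (mu - lam)) ≠ 0 := fun h => r5 (by
    rw [eq_div_iff hn0]; linear_combination -h)
  have hQ : ConfEquivariant lam mu (quantization (U := U) α β₁ β₂ β₃ β₄).toLinearMap := by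
    apply confEquivariant_quantization <;> try rw [hN]
    · rw [hα, div_mul_cancel₀ _ s3]
    · rw [hβ₁, div_mul_cancel₀ _ s5]; ring
    · rw [hβ₁, hβ₂]; field_simp; ring
    · rw [hβ₁, hβ₃]; field_simp
    · have e : N * (2 * (mu - lam) - 1) - 2 = -(2 + N * (1 - 2 * (mu - lam))) := by ring
      rw [e, hβ₂, hβ₃, hβ₄]
      -- Made an atom so that this denominator cancels as a whole.
      generalize hd : 2 + N * (1 - 2 * (mu - lam)) = d at s2 ⊢
      field_simp
      ring
  refine ⟨quantization α β₁ β₂ β₃ β₄, ⟨hQ, preservesPrincipalSymbol_quantization _ _ _ _ _,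
    isLocalMap_quantization _ _ _ _ _⟩, fun P => ⟨quantEquiv (U := U) α β₁ β₂ β₃ β₄ P, rfl,
    fun i j => add_zero _, fun i => (add_assoc _ _ _).symm, ?_⟩, fun Q' hQ' hS _ => ?_⟩
  · change c0 P + (α • divergence (c1 P) + β₃ • divergence (div2 P)
      + β₄ • divergence (grad (trace P))) = _
    rw [← add_assoc, ← add_assoc]
    simp only [divergence, div2, grad, trace, map_sum, Derivation.map_smul]
  · have h2 : (2 : 𝕜) ≠ 0 := two_ne_zero
    refine eq_quantization hQ (fun h => ?_) (fun h => ?_) (fun h => ?_) (fun h => ?_) (fun h => ?_)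
      hQ' hS <;> simp only [casimirZero, casimirOne, casimirTwo, hN] at h
    · refine mul_ne_zero (mul_ne_zero h2 hn0) s3 ?_
      linear_combination h
    · refine mul_ne_zero h2 s5 ?_
      linear_combination -h
    · refine mul_ne_zero h2 s1 ?_
      linear_combination -h
    · refine mul_ne_zero (mul_ne_zero h2 h2) s4 ?_
      linear_combination -h
    · refine mul_ne_zero h2 s2 ?_
      linear_combination -h
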